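/- Let $K$ be Hilbert's number system: its elements are the formal series $a=\sum_{i\ge N}P_i(s)\,t^i$ with $N\in\mathbb Z$ and $P_i(s)=\sum_{k\ge N_i}\alpha_{k,i}s^k$ a real Laurent series in $s$ ($N_i\in\mathbb Z$ depending on $i$ and on $a$), with coefficientwise addition and with the multiplication determined by $ts=2st$, that is, $\left(\sum_i P_i(s)t^i\right)\left(\sum_j Q_j(s)t^j\right)=\sum_n\left(\sum_{i+j=n}P_i(s)\,Q_j(2^is)\right)t^n$. Call $a\neq 0$ positive if $\alpha_{M,m}>0$, where $m$ is the smallest power of $t$ that occurs in $a$ and $M$ the smallest power of $s$ that occurs in $P_m$, and let $a<b$ mean that $b-a$ is positive. Then: (1) With these operations and this order $K$ is a linearly ordered skew field (division ring). It is proper: $ts=2st\neq st$. It is non-Archimedean; in fact $0<t$, $mt<s$ and $ns<1$ for all natural numbers $m,n$. (2) Consider the coordinate plane over $K$. Points are pairs $(x,y)\in K^2$; lines are given by equations $ax+by+c=0$ with $(a,b)\neq(0,0)$, where two equations that differ by a left factor define the same line. Two distinct lines are parallel if their coefficient pairs $(a_1,b_1)$, $(a_2,b_2)$ are left-proportional.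 For three collinear points, $P_2$ is between $P_1$ and $P_3$ if $x_1<x_2<x_3$ or $x_1>x_2>x_3$, or, on a line parallel to the $y$-axis, if $y_1<y_2<y_3$ or $y_1>y_2>y_3$. This plane satisfies Hilbert's plane incidence axioms, Hilbert's plane order axioms (including Pasch's axiom) and the parallel postulate (through a point outside a line $g$ there is exactly one line not meeting $g$). Two distinct lines are parallel if and only if they have no common point. (3) Adjoin to this plane one improper point for each class of parallel lines, lying on the lines of that class, and a line at infinity consisting of all improper points. The extended plane satisfies the projective incidence axioms (any two distinct points are on exactly one line, any two distinct lines meet in exactly one point, and there are four points no three of which are collinear). Desargues' theorem holds in both directions: for two (nondegenerate) triangles with distinct corresponding vertices and distinct corresponding sides, the lines connecting corresponding vertices go through a point if and only if the intersections of corresponding sides lie on a line. (4) Pappus' theorem is false in the extended plane: it is not true that for every hexagon $p_1\dots p_6$ with distinct vertices lying alternately on two distinct lines, none on both, the points $p_1p_2\cap p_4p_5$, $p_2p_3\cap p_5p_6$, $p_3p_4\cap p_6p_1$ are collinear. Explicitly, let $p_1=(st,0)$, $p_3=(t,0)$, $p_5=(s,0)$ on the $x$-axis and $p_2=(0,t)$,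 $p_4=(0,1)$, $p_6=(0,s)$ on the $y$-axis, and let $$g:\ sy+x-s=0,\quad g':\ sy+x-st=0,\quad k:\ ty+x-t=0,\quad k':\ ty+x-ts=0,\quad l:\ x+y-s=0,\quad l':\ x+y-t=0 .$$ Then $p_1p_2=g'$ is parallel to $p_4p_5=g$, and $p_2p_3=l'$ is parallel to $p_5p_6=l$, but $p_6p_1$ is neither equal nor parallel to $p_3p_4=k$: the parallel to $k$ through $p_6$ is $k'$, which meets the $x$-axis at $(ts,0)\neq(st,0)$. In particular, Pappus' theorem does not follow from the plane incidence and order axioms, the parallel postulate and Desargues' theorem. -/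

import Mathlib

/-! ## The Hilbert number system

A number is a series `∑_{i ≥ N} P_i(s) t^i`, where each coefficient
`P_i(s) = ∑_{k ≥ N_i} α_{k,i} s^k` is a Laurent series in `s` over `ℝ`
(no uniformity of the `N_i` in `i` is required). -/

/-- The Hilbert numbers: Laurent series in `t` whose coefficients are Laurent series in `s`.
The real coefficient `α_{k,i}` of `s^k t^i` in `a` is `(a.series.coeff i).coeff k`. -/
@[ext]
structure HilbertNumber : Type where
  /-- The underlying Laurent series in `t`. -/
  series : LaurentSeries (LaurentSeries ℝ)

namespace HilbertNumber

/-- The series `P(2^i s) = ∑ 2^(i k) α_k s^k`, that is, the series `Q` with `t^i P = Q t^i`. -/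
noncomputable def twist (i : ℤ) (P : LaurentSeries ℝ) : LaurentSeries ℝ where
  coeff k := (2 : ℝ) ^ (i * k) * P.coeff k
  isPWO_support' := P.isPWO_support.mono fun k hk => by
    simp only [Function.mem_support, HahnSeries.mem_support] at hk ⊢
    exact right_ne_zero_of_mul hk

/-- Coefficientwise addition. -/
noncomputable def add (a b : HilbertNumber) : HilbertNumber := ⟨a.series + b.series⟩

/-- Coefficientwise subtraction. -/
noncomputable def sub (a b : HilbertNumber) : HilbertNumber := ⟨a.series - b.series⟩

/-- Multiplication determined by `ts = 2st`: the coefficient of `t^n` in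
`(∑ P_i t^i) (∑ Q_j t^j)` is the finite sum of the `P_i(s) Q_j(2^i s)` with `i + j = n`. -/
noncomputable def mul (a b : HilbertNumber) : HilbertNumber where
  series :=
    { coeff := fun n =>
        ∑ ij ∈ Finset.antidiagonal a.series.isPWO_support b.series.isPWO_support n,
          a.series.coeff ij.1 * twist ij.1 (b.series.coeff ij.2)
      isPWO_support' := by
        refine (a.series.isPWO_support.add b.series.isPWO_support).mono fun n hn => ?_
        obtain ⟨ij, hij, -⟩ := Finset.exists_ne_zero_of_sum_ne_zero hn
        rw [Finset.mem_antidiagonal] at hij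
        exact ⟨ij.1, hij.1, ij.2, hij.2.1, hij.2.2⟩ }

/-- The real number `r`, as the constant series `r s^0 t^0`. -/
noncomputable def ofReal (r : ℝ) : HilbertNumber :=
  ⟨HahnSeries.single 0 (HahnSeries.single 0 r)⟩

/-- The parameter `s = 1 s^1 t^0`. -/
noncomputable def s : HilbertNumber := ⟨HahnSeries.single 0 (HahnSeries.single 1 1)⟩

/-- The parameter `t = 1 s^0 t^1`. -/
noncomputable def t : HilbertNumber := ⟨HahnSeries.single 1 (HahnSeries.single 0 1)⟩

/-- `a` is positive when its leading real coefficient is: take the smallest power of `t` that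
occurs in `a`, and in its coefficient `P_i(s)` the smallest power of `s` that occurs.
(Leading coefficients of zero series are `0`, so `0` is not positive.) -/
def Pos (a : HilbertNumber) : Prop := 0 < a.series.leadingCoeff.leadingCoeff

end HilbertNumber

/-! ## Axioms and theorems of plane geometry

Here `Pt` and `Ln` are the types of points and lines, `I P g` says that `P` lies on `g`, and
`B P Q R` says that `Q` lies between `P` and `R`. -/

namespace PlaneGeometry

variable {Pt Ln : Type*}

/-- All the given points lie on a common line. -/
def Collinear (I : Pt → Ln → Prop) (A B C : Pt) : Prop := ∃ g, I A g ∧ I B g ∧ I C g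

/-- The plane incidence axioms. -/
structure IncidenceAxioms (I : Pt → Ln → Prop) : Prop where
  exists_line : ∀ A B, A ≠ B → ∃ g, I A g ∧ I B g
  line_unique : ∀ A B g h, A ≠ B → I A g → I B g → I A h → I B h → g = h
  two_points : ∀ g, ∃ A B, A ≠ B ∧ I A g ∧ I B g
  three_points : ∃ A B C, A ≠ B ∧ A ≠ C ∧ B ≠ C ∧ ¬ Collinear I A B C

/-- The plane order axioms. -/
structure OrderAxioms (I : Pt → Ln → Prop) (B : Pt → Pt → Pt → Prop) : Prop where
  between_distinct : ∀ P Q R, B P Q R → P ≠ Q ∧ P ≠ R ∧ Q ≠ R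
  between_collinear : ∀ P Q R, B P Q R → Collinear I P Q R
  between_symm : ∀ P Q R, B P Q R → B R Q P
  extend : ∀ P Q, P ≠ Q → ∃ R, B P Q R
  exists_between : ∀ P Q R, P ≠ Q → P ≠ R → Q ≠ R → Collinear I P Q R →
    B P Q R ∨ B Q R P ∨ B R P Q
  between_unique : ∀ P Q R, B P Q R → ¬ B Q R P
  pasch : ∀ P Q R g, ¬ Collinear I P Q R → ¬ I P g → ¬ I Q g → ¬ I R g →
    (∃ X, I X g ∧ B P X Q) → (∃ X, I X g ∧ B P X R) ∨ (∃ X, I X g ∧ B Q X R)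

/-- The parallel postulate: through a point `P` outside `g` there is exactly one line that does
not meet `g`. -/
def ParallelPostulate (I : Pt → Ln → Prop) : Prop :=
  ∀ P g, ¬ I P g → ∃! h, I P h ∧ ∀ Q, ¬ (I Q g ∧ I Q h)

/-- The projective incidence theorems: two points have exactly one connecting line, two lines have
exactly one intersection point, and there is a quadrangle. -/
structure ProjectiveIncidence (I : Pt → Ln → Prop) : Prop where
  line : ∀ A B, A ≠ B → ∃! g, I A g ∧ I B g
  point : ∀ g h, g ≠ h → ∃! A, I A g ∧ I A h
  quadrangle : ∃ A B C D, ¬ Collinear I A B C ∧ ¬ Collinear I A B D ∧ ¬ Collinear I A C D ∧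
    ¬ Collinear I B C D

/-- Desargues' theorem in a projective plane, in both directions. `A` and `A'` are the vertices of
two triangles, `a i` and `a' i` are the sides opposite to `A i` and `A' i`, corresponding vertices
and corresponding sides are distinct, `c i` connects `A i` and `A' i`, and `X i` is the
intersection of `a i` and `a' i`. Then the `c i` go through a point if and only if the `X i` lie
on a line. -/
def Desargues (I : Pt → Ln → Prop) : Prop :=
  ∀ (A A' : Fin 3 → Pt) (a a' : Fin 3 → Ln) (c : Fin 3 → Ln) (X : Fin 3 → Pt),
    ¬ Collinear I (A 0) (A 1) (A 2) → ¬ Collinear I (A' 0) (A' 1) (A' 2) →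
    (∀ i j, i ≠ j → I (A j) (a i)) → (∀ i j, i ≠ j → I (A' j) (a' i)) →
    (∀ i, A i ≠ A' i) → (∀ i, a i ≠ a' i) →
    (∀ i, I (A i) (c i) ∧ I (A' i) (c i)) →
    (∀ i, I (X i) (a i) ∧ I (X i) (a' i)) →
    ((∃ O, ∀ i, I O (c i)) ↔ (∃ l, ∀ i, I (X i) l))

/-- The points `p₁, …, p₆` are the vertices of a hexagon that lie alternately on the two distinct
lines `g` and `h`; they are distinct, and none of them lies on both lines. -/
structure PappusHexagon (I : Pt → Ln → Prop) (g h : Ln) (p₁ p₂ p₃ p₄ p₅ p₆ : Pt) : Prop where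
  lines_ne : g ≠ h
  on_g : I p₁ g ∧ I p₃ g ∧ I p₅ g
  on_h : I p₂ h ∧ I p₄ h ∧ I p₆ h
  not_on_h : ¬ I p₁ h ∧ ¬ I p₃ h ∧ ¬ I p₅ h
  not_on_g : ¬ I p₂ g ∧ ¬ I p₄ g ∧ ¬ I p₆ g
  ne_on_g : p₁ ≠ p₃ ∧ p₁ ≠ p₅ ∧ p₃ ≠ p₅
  ne_on_h : p₂ ≠ p₄ ∧ p₂ ≠ p₆ ∧ p₄ ≠ p₆

/-- Pappus' theorem in a projective plane: if the vertices of a hexagon lie alternately on `g` and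
`h`, then the intersections `P, Q, R` of opposite sides lie on a line. -/
def Pappus (I : Pt → Ln → Prop) : Prop :=
  ∀ (g h : Ln) (p₁ p₂ p₃ p₄ p₅ p₆ : Pt), PappusHexagon I g h p₁ p₂ p₃ p₄ p₅ p₆ →
    ∀ (l₁₂ l₂₃ l₃₄ l₄₅ l₅₆ l₆₁ : Ln),
      I p₁ l₁₂ ∧ I p₂ l₁₂ → I p₂ l₂₃ ∧ I p₃ l₂₃ → I p₃ l₃₄ ∧ I p₄ l₃₄ →
      I p₄ l₄₅ ∧ I p₅ l₄₅ → I p₅ l₅₆ ∧ I p₆ l₅₆ → I p₆ l₆₁ ∧ I p₁ l₆₁ →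
      ∀ P Q R : Pt, I P l₁₂ ∧ I P l₄₅ → I Q l₂₃ ∧ I Q l₅₆ → I R l₃₄ ∧ I R l₆₁ →
        Collinear I P Q R

end PlaneGeometry

/-! ## The coordinate plane over an ordered skew field -/

namespace CoordPlane

/-- An equation `a x + b y + c = 0` of a line; `a` and `b` are not both `0`. -/
@[ext]
structure LineEq (K : Type*) [DivisionRing K] where
  a : K
  b : K
  c : K
  ne : a ≠ 0 ∨ b ≠ 0

variable {K : Type*} [DivisionRing K]

/-- If the coefficients `a`, `b` of one equation are a left multiple of those of another, then the
factor is not `0`. -/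
theorem LineEq.factor_ne_zero {u v : LineEq K} {l : K} (ha : u.a = l * v.a)
    (hb : u.b = l * v.b) : l ≠ 0 := by
  rintro rfl
  rcases u.ne with h | h
  · exact h (by simpa using ha)
  · exact h (by simpa using hb)

/-- Two equations define the same line when they are proportional (with a factor on the left). -/
def LineEq.sameLine (K : Type*) [DivisionRing K] : Setoid (LineEq K) where
  r u v := ∃ l : K, u.a = l * v.a ∧ u.b = l * v.b ∧ u.c = l * v.c
  iseqv :=
    { refl := fun _ => ⟨1, by simp⟩
      symm := by
        rintro u v ⟨l, ha, hb, hc⟩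
        have hl := LineEq.factor_ne_zero ha hb
        exact ⟨l⁻¹, by simp [ha, hl], by simp [hb, hl], by simp [hc, hl]⟩
      trans := by
        rintro u v w ⟨l, ha, hb, hc⟩ ⟨m, ha', hb', hc'⟩
        exact ⟨l * m, by rw [ha, ha', mul_assoc], by rw [hb, hb', mul_assoc],
          by rw [hc, hc', mul_assoc]⟩ }

/-- Two equations define lines of the same parallel class when the coefficients `a`, `b` are
proportional (with a factor on the left). -/
def LineEq.sameDirection (K : Type*) [DivisionRing K] : Setoid (LineEq K) where
  r u v := ∃ l : K, u.a = l * v.a ∧ u.b = l * v.b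
  iseqv :=
    { refl := fun _ => ⟨1, by simp⟩
      symm := by
        rintro u v ⟨l, ha, hb⟩
        have hl := LineEq.factor_ne_zero ha hb
        exact ⟨l⁻¹, by simp [ha, hl], by simp [hb, hl]⟩
      trans := by
        rintro u v w ⟨l, ha, hb⟩ ⟨m, ha', hb'⟩
        exact ⟨l * m, by rw [ha, ha', mul_assoc], by rw [hb, hb', mul_assoc]⟩ }

/-- The lines of the coordinate plane over `K`. The points are the pairs `(x, y) : K × K`. -/
def Line (K : Type*) [DivisionRing K] : Type _ := Quotient (LineEq.sameLine K)

/-- The improper points, one for each class of parallel lines. -/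
def ImproperPoint (K : Type*) [DivisionRing K] : Type _ := Quotient (LineEq.sameDirection K)

/-- The line `a x + b y + c = 0`. -/
def Line.mk (a b c : K) (ne : a ≠ 0 ∨ b ≠ 0) : Line K :=
  Quotient.mk (LineEq.sameLine K) ⟨a, b, c, ne⟩

/-- The point `P = (x, y)` lies on the line `a x + b y + c = 0`. -/
def Lies (P : K × K) (g : Line K) : Prop :=
  Quotient.lift (s := LineEq.sameLine K) (fun u => u.a * P.1 + u.b * P.2 + u.c = 0) (by
    rintro u v ⟨l, ha, hb, hc⟩
    have hl := LineEq.factor_ne_zero ha hb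
    have key : u.a * P.1 + u.b * P.2 + u.c = l * (v.a * P.1 + v.b * P.2 + v.c) := by
      rw [ha, hb, hc, mul_add, mul_add, mul_assoc, mul_assoc]
    simp [key, hl]) g

/-- The improper point of a line. -/
def Line.improper (g : Line K) : ImproperPoint K :=
  Quotient.lift (s := LineEq.sameLine K) (fun u => Quotient.mk (LineEq.sameDirection K) u) (by
    rintro u v ⟨l, ha, hb, -⟩
    exact Quotient.sound (s := LineEq.sameDirection K) ⟨l, ha, hb⟩) g

/-- Two lines are parallel when their equations satisfy `a₁ = l a₂`, `b₁ = l b₂`, `c₁ ≠ l c₂` for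
some `l`: the coefficients `a`, `b` are proportional, but the equations are not. -/
def Parallel (g h : Line K) : Prop := g ≠ h ∧ g.improper = h.improper

/-- `y` is strictly between `x` and `z`. -/
def NumBetween [LinearOrder K] (x y z : K) : Prop := (x < y ∧ y < z) ∨ (x > y ∧ y > z)

/-- `P₂` lies between the points `P₁` and `P₃` of a line: the abscissas are ordered accordingly, or
the line is parallel to the `y`-axis and the ordinates are ordered accordingly. -/
def Between [LinearOrder K] (P₁ P₂ P₃ : K × K) : Prop :=
  PlaneGeometry.Collinear Lies P₁ P₂ P₃ ∧
    (NumBetween P₁.1 P₂.1 P₃.1 ∨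
      (P₁.1 = P₂.1 ∧ P₂.1 = P₃.1 ∧ NumBetween P₁.2 P₂.2 P₃.2))

/-- The points of the coordinate plane and the improper points. -/
inductive ExtPoint (K : Type*) [DivisionRing K]
  | proper (P : K × K)
  | improper (d : ImproperPoint K)

/-- The lines of the coordinate plane and the line at infinity. -/
inductive ExtLine (K : Type*) [DivisionRing K]
  | proper (g : Line K)
  | infinity

/-- Incidence in the coordinate plane extended by improper points: an improper point lies on the
lines of its parallel class and on the line at infinity. -/
def ExtLies : ExtPoint K → ExtLine K → Prop
  | .proper P, .proper g => Lies P g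
  | .proper _, .infinity => False
  | .improper d, .proper g => g.improper = d
  | .improper _, .infinity => True

end CoordPlane

/-! The noncommutative product is controlled by a representation. Let `P t^i` act on real Laurent
series by `f ↦ P(s) f(2^i s)`; composing such operators reproduces `ts = 2st`. Replacing every
coefficient by its operator embeds the Hilbert numbers into the Hahn series in a central variable
over an endomorphism ring, and the ring axioms are inherited from there (`operatorSeries_mul`,
`operatorSeries_injective`). Inverses are found by solving recursively for coefficients
(`exists_mul_eq_one`). The order respects products because a twist changes a leading coefficient
only by a power of 2, which is positive (`Pos.mul`).

The geometry works over any division ring, with a compatible order for betweenness. The extended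
plane has homogeneous coordinates: columns up to right factors for points, rows up to left factors
for lines. Incidence becomes linear algebra in dimension three, and passing to the opposite skew
field exchanges points and lines. One direction of Desargues is a linear relation between the three
intersection points (`exists_axis`); the other is its dual. The affine incidence axioms and the
parallel postulate follow by removing the line at infinity. For the order axioms, the left-hand side
of an equation is affine along a line, so a line separates two points exactly when their signs
differ (`exists_between_iff`), and Pasch's axiom is a statement about three signs.

In the explicit hexagon two pairs of opposite sides are parallel. Pappus' theorem would make the
third pair parallel too, and that amounts to `ts = st` (`improper_ne`). -/

namespace HilbertNumber

/-! ### The automorphisms `P(s) ↦ P(2^i s)` -/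

@[simp]
theorem coeff_twist (i : ℤ) (P : LaurentSeries ℝ) (k : ℤ) :
    (twist i P).coeff k = (2 : ℝ) ^ (i * k) * P.coeff k := rfl

theorem support_twist (i : ℤ) (P : LaurentSeries ℝ) : (twist i P).support = P.support := by
  ext k
  simp [zpow_ne_zero]

/-- The substitution `P(s) ↦ P(2^i s)` as a ring endomorphism. -/
noncomputable def twistHom (i : ℤ) : LaurentSeries ℝ →+* LaurentSeries ℝ where
  toFun := twist i
  map_one' := by
    ext k
    rw [coeff_twist, HahnSeries.coeff_one]
    split_ifs with h <;> simp [h]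
  map_zero' := by ext k; simp
  map_add' P Q := by ext k; simp [mul_add]
  map_mul' P Q := by
    ext k
    rw [coeff_twist, HahnSeries.coeff_mul, HahnSeries.coeff_mul, Finset.mul_sum]
    simp_rw [support_twist]
    refine Finset.sum_congr rfl fun ij hij => ?_
    rw [Finset.mem_antidiagonal] at hij
    -- Multiplicativity is `2^(i(k+l)) = 2^(ik) 2^(il)`, applied term by term.
    rw [coeff_twist, coeff_twist, ← hij.2.2, mul_add, zpow_add₀ two_ne_zero]
    ring

@[simp]
theorem twist_zero (i : ℤ) : twist i 0 = 0 := map_zero (twistHom i)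

@[simp]
theorem twist_one (i : ℤ) : twist i 1 = 1 := map_one (twistHom i)

theorem twist_mul (i : ℤ) (P Q : LaurentSeries ℝ) : twist i (P * Q) = twist i P * twist i Q :=
  map_mul (twistHom i) P Q

theorem twist_add_index (i j : ℤ) (P : LaurentSeries ℝ) :
    twist (i + j) P = twist i (twist j P) := by
  ext k
  rw [coeff_twist, coeff_twist, coeff_twist, add_mul, zpow_add₀ two_ne_zero, mul_assoc]

@[simp]
theorem twist_index_zero (P : LaurentSeries ℝ) : twist 0 P = P := by
  ext k
  simp

theorem order_twist (i : ℤ) (P : LaurentSeries ℝ) : (twist i P).order = P.order := by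
  rcases eq_or_ne P 0 with rfl | hP
  · simp
  · apply le_antisymm
    · refine HahnSeries.order_le_of_coeff_ne_zero ?_
      rw [coeff_twist]
      exact mul_ne_zero (zpow_ne_zero _ two_ne_zero) (mt HahnSeries.coeff_order_eq_zero.1 hP)
    · refine HahnSeries.order_le_of_coeff_ne_zero fun h => ?_
      have hT : twist i P ≠ 0 := fun h0 => by
        have := congrArg (fun Q => HahnSeries.coeff Q P.order) h0
        simp [zpow_ne_zero] at this
        exact hP this
      refine mt HahnSeries.coeff_order_eq_zero.1 hT ?_
      rw [coeff_twist, h, mul_zero]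

theorem leadingCoeff_twist (i : ℤ) (P : LaurentSeries ℝ) :
    (twist i P).leadingCoeff = 2 ^ (i * P.order) * P.leadingCoeff := by
  rw [HahnSeries.leadingCoeff_eq, HahnSeries.leadingCoeff_eq, order_twist, coeff_twist]

/-! ### The ring structure -/

noncomputable scoped instance : Zero HilbertNumber := ⟨⟨0⟩⟩
noncomputable scoped instance : One HilbertNumber := ⟨⟨1⟩⟩
noncomputable scoped instance : Add HilbertNumber := ⟨add⟩
noncomputable scoped instance : Sub HilbertNumber := ⟨sub⟩
noncomputable scoped instance : Neg HilbertNumber := ⟨fun a => ⟨-a.series⟩⟩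
noncomputable scoped instance : Mul HilbertNumber := ⟨mul⟩
noncomputable scoped instance : SMul ℕ HilbertNumber := ⟨fun n a => ⟨n • a.series⟩⟩
noncomputable scoped instance : SMul ℤ HilbertNumber := ⟨fun n a => ⟨n • a.series⟩⟩

@[simp] theorem series_zero : (0 : HilbertNumber).series = 0 := rfl
@[simp] theorem series_one : (1 : HilbertNumber).series = 1 := rfl
@[simp] theorem series_add (a b : HilbertNumber) : (a + b).series = a.series + b.series := rfl
@[simp] theorem series_sub (a b : HilbertNumber) : (a - b).series = a.series - b.series := rfl
@[simp] theorem series_neg (a : HilbertNumber) : (-a).series = -a.series := rfl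

theorem series_injective : Function.Injective series := fun _ _ => HilbertNumber.ext

noncomputable scoped instance : AddCommGroup HilbertNumber :=
  series_injective.addCommGroup series rfl (fun _ _ => rfl) (fun _ => rfl) (fun _ _ => rfl)
    (fun _ _ => rfl) (fun _ _ => rfl)

@[simp] theorem series_nsmul (n : ℕ) (a : HilbertNumber) : (n • a).series = n • a.series := rfl

theorem coeff_series_mul (a b : HilbertNumber) (n : ℤ) : (a * b).series.coeff n =
    ∑ ij ∈ Finset.antidiagonal a.series.isPWO_support b.series.isPWO_support n,
      a.series.coeff ij.1 * twist ij.1 (b.series.coeff ij.2) := rfl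

/-- The operator `f ↦ P(s) f(2^i s)` on Laurent series, which represents `P t^i`. -/
noncomputable def operator (i : ℤ) (P : LaurentSeries ℝ) : AddMonoid.End (LaurentSeries ℝ) :=
  (AddMonoidHom.mulLeft P).comp (twistHom i).toAddMonoidHom

theorem operator_apply (i : ℤ) (P f : LaurentSeries ℝ) : operator i P f = P * twist i f := rfl

theorem operator_mul (i j : ℤ) (P Q : LaurentSeries ℝ) :
    operator i P * operator j Q = operator (i + j) (P * twist i Q) := by
  ext1 f
  change operator i P (operator j Q f) = _
  rw [operator_apply, operator_apply, operator_apply, twist_mul,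
    twist_add_index, mul_assoc]

theorem operator_add (i : ℤ) (P Q : LaurentSeries ℝ) :
    operator i (P + Q) = operator i P + operator i Q := by
  ext1 f
  change _ = operator i P f + operator i Q f
  simp only [operator_apply, add_mul]

/-- `operator` as an additive map. -/
noncomputable def operatorHom (i : ℤ) :
    LaurentSeries ℝ →+ AddMonoid.End (LaurentSeries ℝ) :=
  AddMonoidHom.mk' (operator i) (operator_add i)

theorem operatorHom_apply (i : ℤ) (P : LaurentSeries ℝ) : operatorHom i P = operator i P := rfl

/-- The constant series `1` is fixed by every twist, so evaluating the operator there recovers `P`.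
-/
theorem operator_injective (i : ℤ) : Function.Injective (operator i) := fun P Q h => by
  simpa [operator_apply] using DFunLike.congr_fun h 1

theorem operator_eq_zero_iff {i : ℤ} {P : LaurentSeries ℝ} : operator i P = 0 ↔ P = 0 :=
  map_eq_zero_iff (operatorHom i) (operator_injective i)

/-- The representation of a Hilbert number as a series of operators in a central variable. -/
noncomputable def operatorSeries (a : HilbertNumber) :
    HahnSeries ℤ (AddMonoid.End (LaurentSeries ℝ)) where
  coeff i := operator i (a.series.coeff i)
  isPWO_support' := a.series.isPWO_support.mono fun i hi => by
    simpa [operator_eq_zero_iff] using hi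

theorem coeff_operatorSeries (a : HilbertNumber) (i : ℤ) :
    a.operatorSeries.coeff i = operator i (a.series.coeff i) := rfl

theorem support_operatorSeries (a : HilbertNumber) :
    a.operatorSeries.support = a.series.support := by
  ext i
  simp [coeff_operatorSeries, operator_eq_zero_iff]

theorem operatorSeries_injective : Function.Injective operatorSeries := fun a b h => by
  ext1
  ext1
  funext i
  exact operator_injective i (congrArg (fun x => HahnSeries.coeff x i) h)

theorem operatorSeries_add (a b : HilbertNumber) :
    (a + b).operatorSeries = a.operatorSeries + b.operatorSeries := by
  ext1
  funext i
  exact operator_add i _ _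

theorem operatorSeries_zero : (0 : HilbertNumber).operatorSeries = 0 := by
  ext1
  funext i
  exact operator_eq_zero_iff.2 rfl

theorem operatorSeries_one : (1 : HilbertNumber).operatorSeries = 1 := by
  ext1
  funext i
  rw [coeff_operatorSeries, series_one, HahnSeries.coeff_one, HahnSeries.coeff_one]
  split_ifs with h
  · subst h
    ext1 f
    simp [operator_apply]
  · exact operator_eq_zero_iff.2 rfl

/-- Passing to operators does not change supports, so both products are sums over the same index
pairs, and `operator_mul` matches the terms. The twist in the product of Hilbert numbers is absorbed
into composition. -/
theorem operatorSeries_mul (a b : HilbertNumber) :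
    (a * b).operatorSeries = a.operatorSeries * b.operatorSeries := by
  ext1
  funext n
  rw [coeff_operatorSeries, coeff_series_mul, HahnSeries.coeff_mul, ← operatorHom_apply, map_sum]
  simp_rw [support_operatorSeries]
  refine Finset.sum_congr rfl fun ij hij => ?_
  rw [Finset.mem_antidiagonal] at hij
  rw [coeff_operatorSeries, coeff_operatorSeries, operator_mul, hij.2.2, operatorHom_apply]

noncomputable scoped instance : Ring HilbertNumber where
  __ := (inferInstance : AddCommGroup HilbertNumber)
  zero_mul a := operatorSeries_injective (by
    rw [operatorSeries_mul, operatorSeries_zero, zero_mul])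
  mul_zero a := operatorSeries_injective (by
    rw [operatorSeries_mul, operatorSeries_zero, mul_zero])
  one_mul a := operatorSeries_injective (by rw [operatorSeries_mul, operatorSeries_one, one_mul])
  mul_one a := operatorSeries_injective (by rw [operatorSeries_mul, operatorSeries_one, mul_one])
  mul_assoc a b c := operatorSeries_injective (by simp only [operatorSeries_mul, mul_assoc])
  left_distrib a b c := operatorSeries_injective (by
    simp only [operatorSeries_mul, operatorSeries_add, mul_add])
  right_distrib a b c := operatorSeries_injective (by
    simp only [operatorSeries_mul, operatorSeries_add, add_mul])

/-! ### Inverses -/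

/-- Terms outside the supports vanish, so any convenient finite set of index pairs covering them may
replace the antidiagonal. -/
theorem coeff_series_mul_of_subset (a b : HilbertNumber) (n : ℤ) (F : Finset (ℤ × ℤ))
    (hF : ∀ ij ∈ F, ij.1 + ij.2 = n)
    (hs : ∀ i j, i + j = n → a.series.coeff i ≠ 0 → b.series.coeff j ≠ 0 → (i, j) ∈ F) :
    (a * b).series.coeff n =
      ∑ ij ∈ F, a.series.coeff ij.1 * twist ij.1 (b.series.coeff ij.2) := by
  rw [coeff_series_mul]
  refine Finset.sum_subset (fun ij hij => ?_) fun ij hij hn => ?_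
  · rw [Finset.mem_antidiagonal] at hij
    exact hs _ _ hij.2.2 hij.1 hij.2.1
  · by_contra h
    refine hn (Finset.mem_antidiagonal.2 ⟨fun h0 => h ?_, fun h0 => h ?_, hF _ hij⟩)
    · rw [h0, zero_mul]
    · rw [h0, twist_zero, mul_zero]

theorem coeff_series_mul_single (a b : HilbertNumber) (i j : ℤ)
    (ha : ∀ k < i, a.series.coeff k = 0) (hb : ∀ k < j, b.series.coeff k = 0) :
    (a * b).series.coeff (i + j) = a.series.coeff i * twist i (b.series.coeff j) := by
  rw [coeff_series_mul_of_subset a b (i + j) {(i, j)} (by simp), Finset.sum_singleton]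
  intro k l hkl hk hl
  have h1 : i ≤ k := not_lt.1 fun h => hk (ha k h)
  have h2 : j ≤ l := not_lt.1 fun h => hl (hb l h)
  rw [Finset.mem_singleton, Prod.mk.injEq]
  omega

theorem coeff_series_mul_eq_zero (a b : HilbertNumber) (i j n : ℤ)
    (ha : ∀ k < i, a.series.coeff k = 0) (hb : ∀ k < j, b.series.coeff k = 0) (hn : n < i + j) :
    (a * b).series.coeff n = 0 := by
  rw [coeff_series_mul_of_subset a b n ∅ (by simp), Finset.sum_empty]
  intro k l hkl hk hl
  have h1 : i ≤ k := not_lt.1 fun h => hk (ha k h)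
  have h2 : j ≤ l := not_lt.1 fun h => hl (hb l h)
  omega

/-- The coefficient of `t^(n - m)` in the inverse of `∑_{i ≥ m} a_i t^i`. -/
noncomputable def invCoeff (m : ℤ) (a : ℤ → LaurentSeries ℝ) (n : ℕ) : LaurentSeries ℝ :=
  twist (-m) ((a m)⁻¹ * ((if n = 0 then 1 else 0) -
    ∑ k : Fin n, a (m + n - k) * twist (m + n - k) (invCoeff m a k)))
termination_by n
decreasing_by exact k.2

/-- The newest coefficient occurs only in the last term, as `a m * twist m _`. The recursion undoes
this by `twist (-m)` and `(a m)⁻¹`, which leaves exactly the required value minus the earlier terms.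
-/
theorem sum_mul_invCoeff (m : ℤ) (a : ℤ → LaurentSeries ℝ) (ha : a m ≠ 0) (n : ℕ) :
    ∑ k ∈ Finset.range (n + 1), a (m + n - k) * twist (m + n - k) (invCoeff m a k) =
      if n = 0 then 1 else 0 := by
  rw [Finset.sum_range_succ, add_sub_cancel_right]
  rw [invCoeff.eq_1 m a n]
  rw [← twist_add_index, add_neg_cancel, twist_index_zero, mul_inv_cancel_left₀ ha,
    Finset.sum_range, add_sub_cancel]

theorem exists_mul_eq_one (a : HilbertNumber) (ha : a ≠ 0) : ∃ b : HilbertNumber, a * b = 1 := by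
  have ha' : a.series ≠ 0 := fun h => ha (HilbertNumber.ext h)
  set m := a.series.order with hm
  have hlow : ∀ k < m, a.series.coeff k = 0 := fun k hk => HahnSeries.coeff_eq_zero_of_lt_order hk
  let c : ℤ → LaurentSeries ℝ :=
    fun j => if -m ≤ j then invCoeff m a.series.coeff (j + m).toNat else 0
  have hc : ∀ j < -m, c j = 0 := fun j hj => if_neg (not_le.2 hj)
  let b : HilbertNumber := ⟨HahnSeries.ofSuppBddBelow c
    ⟨-m, fun j hj => not_lt.1 fun h => hj (hc j h)⟩⟩
  have hb : ∀ j, b.series.coeff j = c j := fun _ => rfl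
  refine ⟨b, ?_⟩
  ext1
  ext1
  funext n
  rw [series_one, HahnSeries.coeff_one]
  rcases lt_or_ge n 0 with hn | hn
  · rw [coeff_series_mul_eq_zero a b m (-m) n hlow hc (by omega), if_neg (by omega)]
  · obtain ⟨n, rfl⟩ := Int.eq_ofNat_of_zero_le hn
    have key := sum_mul_invCoeff m a.series.coeff (mt HahnSeries.coeff_order_eq_zero.1 ha') n
    -- The pairs `(m + n - k, k - m)` with `0 ≤ k ≤ n` are all the pairs of sum `n` whose entries
    -- are at least `m` and `-m`.
    rw [coeff_series_mul_of_subset a b n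
      ((Finset.range (n + 1)).image fun k : ℕ => ((m + n - k, k - m) : ℤ × ℤ)), Finset.sum_image]
    · simp only [Nat.cast_eq_zero]
      rw [← key]
      refine Finset.sum_congr rfl fun k hk => ?_
      have : c (k - m) = invCoeff m a.series.coeff k := by
        simp only [c]
        rw [if_pos (by omega), sub_add_cancel, Int.toNat_natCast]
      rw [hb, this]
    · intro k _ l _ h
      simpa using congrArg Prod.snd h
    · intro ij hij
      obtain ⟨k, -, rfl⟩ := Finset.mem_image.1 hij
      simp
    · intro i j hij hi hj
      have h1 : m ≤ i := not_lt.1 fun h => hi (hlow i h)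
      have h2 : -m ≤ j := not_lt.1 fun h => hj (hc j h)
      refine Finset.mem_image.2 ⟨(j + m).toNat, Finset.mem_range.2 (by omega), ?_⟩
      ext <;> simp <;> omega

scoped instance : Nontrivial HilbertNumber :=
  ⟨⟨0, 1, fun h => by simpa using congrArg (fun a => HahnSeries.coeff a.series 0) h⟩⟩

open Classical in
noncomputable scoped instance divisionRing : DivisionRing HilbertNumber where
  inv a := if h : a = 0 then 0 else (exists_mul_eq_one a h).choose
  mul_inv_cancel a h := by
    simp only [dif_neg h]
    exact (exists_mul_eq_one a h).choose_spec
  inv_zero := dif_pos rfl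
  nnqsmul := _
  nnqsmul_def := fun _ _ => rfl
  qsmul := _
  qsmul_def := fun _ _ => rfl

end HilbertNumber

namespace HilbertNumber

/-! ### The order -/

theorem leadingCoeff_eq_coeff {R : Type*} [Zero R] {x : HahnSeries ℤ R} {m : ℤ}
    (hlow : ∀ i < m, x.coeff i = 0) (hm : x.coeff m ≠ 0) : x.leadingCoeff = x.coeff m := by
  rw [HahnSeries.leadingCoeff_eq]
  congr 1
  refine le_antisymm (HahnSeries.order_le_of_coeff_ne_zero hm) (not_lt.1 fun h => ?_)
  have hx : x ≠ 0 := by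
    rintro rfl
    exact hm rfl
  exact mt HahnSeries.coeff_order_eq_zero.1 hx (hlow _ h)

theorem pos_iff {a : HilbertNumber} : a.Pos ↔ ∃ m M : ℤ, (∀ i < m, a.series.coeff i = 0) ∧
    (∀ k < M, (a.series.coeff m).coeff k = 0) ∧ 0 < (a.series.coeff m).coeff M := by
  constructor
  · intro h
    refine ⟨a.series.order, a.series.leadingCoeff.order,
      fun i hi => HahnSeries.coeff_eq_zero_of_lt_order hi, fun k hk => ?_, ?_⟩
    · rw [← HahnSeries.leadingCoeff_eq]
      exact HahnSeries.coeff_eq_zero_of_lt_order hk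
    · rw [← HahnSeries.leadingCoeff_eq, ← HahnSeries.leadingCoeff_eq]
      exact h
  · rintro ⟨m, M, hm, hM, h⟩
    have hne : a.series.coeff m ≠ 0 := fun h0 => by simp [h0] at h
    rw [Pos, leadingCoeff_eq_coeff hm hne, leadingCoeff_eq_coeff hM h.ne']
    exact h

/-- The summand whose leading term comes first in the lexicographic order of exponents decides; if
both leading exponents agree, two positive reals are added and nothing cancels. -/
theorem Pos.add {a b : HilbertNumber} (ha : a.Pos) (hb : b.Pos) : (a + b).Pos := by
  obtain ⟨m, M, hm, hM, h⟩ := pos_iff.1 ha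
  obtain ⟨n, N, hn, hN, h'⟩ := pos_iff.1 hb
  rw [pos_iff]
  rcases lt_trichotomy m n with hmn | rfl | hmn
  · refine ⟨m, M, fun i hi => ?_, fun k hk => ?_, ?_⟩
    · simp [hm i hi, hn i (hi.trans hmn)]
    · simp [hM k hk, hn m hmn]
    · simpa [hn m hmn] using h
  · refine ⟨m, min M N, fun i hi => ?_, fun k hk => ?_, ?_⟩
    · simp [hm i hi, hn i hi]
    · simp [hM k (lt_min_iff.1 hk).1, hN k (lt_min_iff.1 hk).2]
    · rcases lt_trichotomy M N with hMN | rfl | hMN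
      · simpa [min_eq_left hMN.le, hN M hMN] using h
      · simpa using add_pos h h'
      · simpa [min_eq_right hMN.le, hM N hMN] using h'
  · refine ⟨n, N, fun i hi => ?_, fun k hk => ?_, ?_⟩
    · simp [hn i hi, hm i (hi.trans hmn)]
    · simp [hN k hk, hm n hmn]
    · simpa [hm n hmn] using h'

/-- The lowest coefficient of the product is a single term `P * twist i Q`. Its leading real
coefficient is the product of those of `P` and `Q` times a power of 2. -/
theorem Pos.mul {a b : HilbertNumber} (ha : a.Pos) (hb : b.Pos) : (a * b).Pos := by
  have hlow : ∀ (c : HilbertNumber), ∀ k < c.series.order, c.series.coeff k = 0 :=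
    fun c k hk => HahnSeries.coeff_eq_zero_of_lt_order hk
  set i := a.series.order with hi
  set j := b.series.order with hj
  have hcoeff : (a * b).series.coeff (i + j) =
      a.series.leadingCoeff * twist i b.series.leadingCoeff := by
    rw [coeff_series_mul_single a b i j (hlow a) (hlow b), HahnSeries.leadingCoeff_eq,
      HahnSeries.leadingCoeff_eq]
  have hpos : 0 < ((a * b).series.coeff (i + j)).leadingCoeff := by
    rw [hcoeff, HahnSeries.leadingCoeff_mul, leadingCoeff_twist]
    exact mul_pos ha (mul_pos (zpow_pos two_pos _) hb)
  have hne : (a * b).series.coeff (i + j) ≠ 0 := fun h0 => by simp [h0] at hpos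
  rw [Pos, leadingCoeff_eq_coeff
    (fun n hn => coeff_series_mul_eq_zero a b i j n (hlow a) (hlow b) hn) hne]
  exact hpos

theorem not_pos_zero : ¬ (0 : HilbertNumber).Pos := by
  simp [Pos]

theorem eq_zero_or_pos (a : HilbertNumber) : a = 0 ∨ a.Pos ∨ (-a).Pos := by
  simp only [Pos, series_neg, HahnSeries.leadingCoeff_neg, Left.neg_pos_iff]
  rcases lt_trichotomy 0 a.series.leadingCoeff.leadingCoeff with h | h | h
  · exact Or.inr (Or.inl h)
  · left
    ext1
    simpa using h.symm
  · exact Or.inr (Or.inr h)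

open Classical in
noncomputable scoped instance linearOrder : LinearOrder HilbertNumber :=
  let lt : HilbertNumber → HilbertNumber → Prop := fun a b => (b - a).Pos
  haveI : IsStrictTotalOrder HilbertNumber lt :=
    { trichotomous := fun a b h₁ h₂ => by
        rcases eq_zero_or_pos (b - a) with h | h | h
        · exact (sub_eq_zero.1 h).symm
        · exact (h₁ h).elim
        · rw [neg_sub] at h
          exact (h₂ h).elim
      irrefl := fun a h => not_pos_zero (by rwa [← sub_self a])
      trans := fun a b c h h' => by
        have := h'.add h
        rwa [sub_add_sub_cancel] at this }
  linearOrderOfSTO lt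

theorem lt_iff_pos_sub {a b : HilbertNumber} : a < b ↔ (b - a).Pos := Iff.rfl

theorem zero_lt_iff_pos {a : HilbertNumber} : 0 < a ↔ a.Pos := by
  rw [lt_iff_pos_sub, sub_zero]

scoped instance : IsOrderedAddMonoid HilbertNumber where
  add_le_add_left a b h c := by
    rcases h.eq_or_lt with rfl | h
    · exact le_rfl
    · refine le_of_lt ?_
      rw [lt_iff_pos_sub] at h ⊢
      simpa using h

theorem pos_one : (1 : HilbertNumber).Pos := by
  simp [Pos]

scoped instance : ZeroLEOneClass HilbertNumber := ⟨(zero_lt_iff_pos.2 pos_one).le⟩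

scoped instance isStrictOrderedRing : IsStrictOrderedRing HilbertNumber :=
  IsStrictOrderedRing.of_mul_pos fun a b ha hb => by
    rw [zero_lt_iff_pos] at *
    exact ha.mul hb

/-! ### The parameters -/

theorem pos_s : s.Pos := by simp [Pos, s]

theorem pos_t : t.Pos := by simp [Pos, t]

theorem nsmul_t_lt_s (m : ℕ) : m * t < s := by
  rw [lt_iff_pos_sub, ← nsmul_eq_mul, pos_iff]
  -- The difference `s - m t` has leading term `s t^0`, with coefficient 1.
  refine ⟨0, 1, fun i hi => ?_, fun k hk => ?_, ?_⟩
  · simp [-nsmul_eq_mul, s, t, hi.ne, (hi.trans one_pos).ne]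
  · simp [-nsmul_eq_mul, s, t, hk.ne]
  · simp [-nsmul_eq_mul, s, t]

theorem nsmul_s_lt_one (n : ℕ) : n * s < 1 := by
  rw [lt_iff_pos_sub, ← nsmul_eq_mul, pos_iff]
  refine ⟨0, 0, fun i hi => ?_, fun k hk => ?_, ?_⟩
  · simp [-nsmul_eq_mul, s, HahnSeries.coeff_one, hi.ne]
  · simp [-nsmul_eq_mul, s, HahnSeries.coeff_one, hk.ne, (hk.trans one_pos).ne]
  · simp [-nsmul_eq_mul, s, HahnSeries.coeff_one]

theorem not_archimedean : ¬ Archimedean HilbertNumber := fun h => by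
  obtain ⟨n, hn⟩ := h.arch 1 (zero_lt_iff_pos.2 pos_s)
  rw [nsmul_eq_mul] at hn
  exact (nsmul_s_lt_one n).not_ge hn

theorem t_mul_s : t * s = 2 * (s * t) := by
  have single_mul : ∀ (i j : ℤ) (P Q : LaurentSeries ℝ),
      (⟨HahnSeries.single i P⟩ * ⟨HahnSeries.single j Q⟩ : HilbertNumber) =
        ⟨HahnSeries.single (i + j) (P * twist i Q)⟩ := by
    intro i j P Q
    ext1
    ext1
    funext n
    by_cases hn : i + j = n
    · rw [coeff_series_mul_of_subset _ _ n {(i, j)} (by simpa using hn), Finset.sum_singleton]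
      · simp [hn]
      · intro k l _ hk hl
        simp only [HahnSeries.coeff_single, ne_eq, ite_eq_right_iff, Classical.not_imp] at hk hl
        simp [hk.1, hl.1]
    · rw [coeff_series_mul_of_subset _ _ n ∅ (by simp), Finset.sum_empty]
      · simp [Ne.symm hn]
      · intro k l hkl hk hl
        simp only [HahnSeries.coeff_single, ne_eq, ite_eq_right_iff, Classical.not_imp] at hk hl
        exact (hn (by rw [← hk.1, ← hl.1, hkl])).elim
  have h1 : t * s = ⟨HahnSeries.single 1 (HahnSeries.single 1 2)⟩ := by
    rw [t, s, single_mul]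
    -- The factor 2 is `2^(1 * 1)`, from twisting `s` by the exponent of `t`.
    congr 2
    ext k
    by_cases hk : k = 1
    · simp [hk]
    · simp [hk]
  have h2 : s * t = ⟨HahnSeries.single 1 (HahnSeries.single 1 1)⟩ := by
    rw [t, s, single_mul]
    simp
  rw [h1, h2, two_mul]
  ext1
  rw [series_add, ← HahnSeries.single_add, ← HahnSeries.single_add, one_add_one_eq_two]

theorem s_mul_t_pos : 0 < s * t := zero_lt_iff_pos.2 (pos_s.mul pos_t)

theorem t_mul_s_ne : t * s ≠ s * t := by
  rw [t_mul_s, two_mul]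
  exact (lt_add_of_pos_left _ s_mul_t_pos).ne'

theorem s_ne_zero : s ≠ 0 := (zero_lt_iff_pos.2 pos_s).ne'

theorem t_ne_zero : t ≠ 0 := (zero_lt_iff_pos.2 pos_t).ne'

theorem t_lt_s : t < s := by simpa using nsmul_t_lt_s 1

theorem s_lt_one : s < 1 := by simpa using nsmul_s_lt_one 1

end HilbertNumber

namespace PlaneGeometry

/-! ### Homogeneous coordinates -/

section LinearAlgebra

variable {K : Type*} [DivisionRing K]

theorem dotProduct_mul_right (u p : Fin 3 → K) (x : K) :
    u ⬝ᵥ (fun i => p i * x) = (u ⬝ᵥ p) * x := by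
  simp only [dotProduct, Finset.sum_mul, mul_assoc]

theorem mul_left_dotProduct (l : K) (u p : Fin 3 → K) :
    (fun i => l * u i) ⬝ᵥ p = l * (u ⬝ᵥ p) := by
  simp only [dotProduct, Finset.mul_sum, mul_assoc]

theorem exists_dotProduct_eq_one {p q : Fin 3 → K} (hq : q ≠ 0)
    (hpq : ∀ x, p ≠ fun i => q i * x) : ∃ h : Fin 3 → K, h ⬝ᵥ p = 1 ∧ h ⬝ᵥ q = 0 := by
  obtain ⟨i, hi⟩ := Function.ne_iff.1 hq
  obtain ⟨j, hj⟩ := Function.ne_iff.1 (hpq ((q i)⁻¹ * p i))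
  have hz : p j - q j * ((q i)⁻¹ * p i) ≠ 0 := sub_ne_zero.2 hj
  set z := p j - q j * ((q i)⁻¹ * p i) with hzdef
  -- The index `j` is one where `p` differs from the right multiple of `q` that agrees with it at
  -- `i`. The row `e_j - q_j q_i⁻¹ e_i` kills `q` and takes the value `z` on `p`; multiplying by
  -- `z⁻¹` on the left normalises it.
  refine ⟨Pi.single j z⁻¹ - Pi.single i (z⁻¹ * (q j * (q i)⁻¹)), ?_, ?_⟩
  · rw [sub_dotProduct, single_dotProduct, single_dotProduct, mul_assoc, ← mul_sub, mul_assoc,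
      ← hzdef, inv_mul_cancel₀ hz]
  · rw [sub_dotProduct, single_dotProduct, single_dotProduct, mul_assoc, ← mul_sub, mul_assoc,
      inv_mul_cancel₀ hi, mul_one, sub_self, mul_zero]

/-- The pairing with two column vectors, as a linear map on row vectors. -/
def pairing (p q : Fin 3 → K) : (Fin 3 → K) →ₗ[K] K × K where
  toFun u := (u ⬝ᵥ p, u ⬝ᵥ q)
  map_add' u v := by simp [add_dotProduct]
  map_smul' l u := by simp [smul_dotProduct]

theorem exists_ne_zero_dotProduct_eq_zero (p q : Fin 3 → K) :
    ∃ u : Fin 3 → K, u ≠ 0 ∧ u ⬝ᵥ p = 0 ∧ u ⬝ᵥ q = 0 := by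
  have h : LinearMap.ker (pairing p q) ≠ ⊥ := LinearMap.ker_ne_bot_of_finrank_lt (by simp)
  obtain ⟨u, hu, hne⟩ := Submodule.exists_mem_ne_zero_of_ne_bot h
  have hu' := Prod.ext_iff.1 (LinearMap.mem_ker.1 hu)
  exact ⟨u, hne, hu'⟩

/-- Independence of `p` and `q` makes the pairing surjective onto a plane, so by rank-nullity its
kernel is one-dimensional. This gives uniqueness of the joining line. -/
theorem eq_mul_of_dotProduct_eq_zero {p q u v : Fin 3 → K} (hp : p ≠ 0) (hq : q ≠ 0)
    (hpq : ∀ x, p ≠ fun i => q i * x) (hqp : ∀ x, q ≠ fun i => p i * x) (hv : v ≠ 0)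
    (hup : u ⬝ᵥ p = 0) (huq : u ⬝ᵥ q = 0) (hvp : v ⬝ᵥ p = 0) (hvq : v ⬝ᵥ q = 0) :
    ∃ l, u = fun i => l * v i := by
  obtain ⟨h, hh₁, hh₂⟩ := exists_dotProduct_eq_one hq hpq
  obtain ⟨k, hk₁, hk₂⟩ := exists_dotProduct_eq_one hp hqp
  have hsurj : LinearMap.range (pairing p q) = ⊤ := by
    rw [LinearMap.range_eq_top]
    rintro ⟨x, y⟩
    refine ⟨x • h + y • k, Prod.ext ?_ ?_⟩
    · simp [pairing, add_dotProduct, smul_dotProduct, hh₁, hk₂]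
    · simp [pairing, add_dotProduct, smul_dotProduct, hh₂, hk₁]
  have hdim := LinearMap.finrank_range_add_finrank_ker (pairing p q)
  rw [hsurj, finrank_top, Module.finrank_prod, Module.finrank_self, Module.finrank_fin_fun] at hdim
  have hker : Module.finrank K (LinearMap.ker (pairing p q)) = 1 := by omega
  have mem : ∀ {w : Fin 3 → K}, w ⬝ᵥ p = 0 → w ⬝ᵥ q = 0 → w ∈ LinearMap.ker (pairing p q) :=
    fun h₁ h₂ => LinearMap.mem_ker.2 (Prod.ext h₁ h₂)
  obtain ⟨l, hl⟩ := exists_smul_eq_of_finrank_eq_one hker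
    (x := ⟨v, mem hvp hvq⟩) (fun h0 => hv (congrArg Subtype.val h0)) ⟨u, mem hup huq⟩
  exact ⟨l, (congrArg Subtype.val hl).symm⟩

end LinearAlgebra

/-- Homogeneous coordinates on an incidence structure: points are the nonzero column vectors up to
factors on the right, and lines are the nonzero row vectors up to factors on the left. -/
structure HomogeneousCoordinates (K : Type*) [DivisionRing K] {Pt Ln : Type*}
    (I : Pt → Ln → Prop) where
  pt : Pt → Fin 3 → K
  ln : Ln → Fin 3 → K
  pt_ne_zero : ∀ P, pt P ≠ 0
  ln_ne_zero : ∀ g, ln g ≠ 0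
  incident_iff : ∀ P g, I P g ↔ ln g ⬝ᵥ pt P = 0
  pt_inj : ∀ P Q x, pt P = (fun i => pt Q i * x) → P = Q
  ln_inj : ∀ g h x, ln g = (fun i => x * ln h i) → g = h
  pt_surj : ∀ v, v ≠ 0 → ∃ P x, v = fun i => pt P i * x
  ln_surj : ∀ v, v ≠ 0 → ∃ g x, v = fun i => x * ln g i

/-! ### Duality and Desargues' theorem in homogeneous coordinates. -/

namespace HomogeneousCoordinates

open MulOpposite

variable {K : Type*} [DivisionRing K] {Pt Ln : Type*} {I : Pt → Ln → Prop}

/-- The coordinates of the dual structure, over the opposite skew field. -/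
def dual (C : HomogeneousCoordinates K I) :
    HomogeneousCoordinates Kᵐᵒᵖ (fun g P => I P g) where
  pt g i := op (C.ln g i)
  ln P i := op (C.pt P i)
  pt_ne_zero g h := C.ln_ne_zero g (funext fun i => op_injective (congrFun h i))
  ln_ne_zero P h := C.pt_ne_zero P (funext fun i => op_injective (congrFun h i))
  incident_iff g P := by
    rw [C.incident_iff P g, ← op_eq_zero_iff]
    simp only [dotProduct, Finset.op_sum, op_mul]
  pt_inj g h x hx := C.ln_inj g h (unop x) (funext fun i => op_injective (congrFun hx i))
  ln_inj P Q x hx := C.pt_inj P Q (unop x) (funext fun i => op_injective (congrFun hx i))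
  pt_surj v hv := by
    obtain ⟨g, x, h⟩ := C.ln_surj (fun i => unop (v i))
      fun h0 => hv (funext fun i => unop_injective (congrFun h0 i))
    exact ⟨g, op x, funext fun i => unop_injective (congrFun h i)⟩
  ln_surj v hv := by
    obtain ⟨g, x, h⟩ := C.pt_surj (fun i => unop (v i))
      fun h0 => hv (funext fun i => unop_injective (congrFun h0 i))
    exact ⟨g, op x, funext fun i => unop_injective (congrFun h i)⟩

theorem exists_line (C : HomogeneousCoordinates K I) (P Q : Pt) : ∃ g, I P g ∧ I Q g := by
  obtain ⟨u, hu, hP, hQ⟩ := exists_ne_zero_dotProduct_eq_zero (C.pt P) (C.pt Q)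
  obtain ⟨g, x, rfl⟩ := C.ln_surj u hu
  have hx : x ≠ 0 := by
    rintro rfl
    exact hu (funext fun i => zero_mul _)
  rw [mul_left_dotProduct] at hP hQ
  exact ⟨g, (C.incident_iff P g).2 ((mul_eq_zero.1 hP).resolve_left hx),
    (C.incident_iff Q g).2 ((mul_eq_zero.1 hQ).resolve_left hx)⟩

theorem line_unique (C : HomogeneousCoordinates K I) {P Q : Pt} {g h : Ln} (hPQ : P ≠ Q)
    (hPg : I P g) (hQg : I Q g) (hPh : I P h) (hQh : I Q h) : g = h := by
  rw [C.incident_iff] at *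
  obtain ⟨l, hl⟩ := eq_mul_of_dotProduct_eq_zero (C.pt_ne_zero P) (C.pt_ne_zero Q)
    (fun x hx => hPQ (C.pt_inj P Q x hx)) (fun x hx => hPQ (C.pt_inj Q P x hx).symm)
    (C.ln_ne_zero h) hPg hQg hPh hQh
  exact C.ln_inj g h l hl

theorem exists_point (C : HomogeneousCoordinates K I) (g h : Ln) : ∃ P, I P g ∧ I P h :=
  C.dual.exists_line g h

theorem point_unique (C : HomogeneousCoordinates K I) {P Q : Pt} {g h : Ln} (hgh : g ≠ h)
    (hPg : I P g) (hPh : I P h) (hQg : I Q g) (hQh : I Q h) : P = Q :=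
  C.dual.line_unique hgh hPg hPh hQg hQh

/-- A nonzero vector in the kernels of two distinct lines is a multiple of their common point. -/
theorem eq_mul_of_mem (C : HomogeneousCoordinates K I) {P : Pt} {g h : Ln} (hgh : g ≠ h)
    (hPg : I P g) (hPh : I P h) {v : Fin 3 → K} (hg : C.ln g ⬝ᵥ v = 0) (hh : C.ln h ⬝ᵥ v = 0) :
    ∃ x, v = fun i => C.pt P i * x := by
  by_cases hv : v = 0
  · exact ⟨0, funext fun i => by simp [hv]⟩
  · obtain ⟨D, x, rfl⟩ := C.pt_surj v hv
    have hx : x ≠ 0 := by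
      rintro rfl
      exact hv (funext fun i => mul_zero _)
    rw [dotProduct_mul_right] at hg hh
    have : D = P := C.point_unique hgh
      ((C.incident_iff D g).2 ((mul_eq_zero.1 hg).resolve_right hx))
      ((C.incident_iff D h).2 ((mul_eq_zero.1 hh).resolve_right hx)) hPg hPh
    exact ⟨x, by rw [this]⟩

/-- Take a line `h` through `Q` but not through `P`, and subtract from `O` the multiple of `P` that
makes the result vanish on `h`. The difference lies on both `g` and `h`, hence is a multiple of `Q`.
-/
theorem exists_eq_mul_add_mul (C : HomogeneousCoordinates K I) {P Q O : Pt} {g : Ln}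
    (hPQ : P ≠ Q) (hP : I P g) (hQ : I Q g) (hO : I O g) :
    ∃ x y, C.pt O = fun i => C.pt P i * x + C.pt Q i * y := by
  obtain ⟨u, huP, huQ⟩ := exists_dotProduct_eq_one (C.pt_ne_zero Q)
    (fun x hx => hPQ (C.pt_inj P Q x hx))
  have hu : u ≠ 0 := by
    rintro rfl
    simp at huP
  obtain ⟨h, l, rfl⟩ := C.ln_surj u hu
  rw [mul_left_dotProduct] at huP huQ
  have hl : l ≠ 0 := by
    rintro rfl
    simp at huP
  have hhP : C.ln h ⬝ᵥ C.pt P ≠ 0 := fun h0 => by simp [h0] at huP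
  have hhQ : I Q h := (C.incident_iff Q h).2 ((mul_eq_zero.1 huQ).resolve_left hl)
  have hgh : g ≠ h := fun h0 => hhP ((C.incident_iff P h).1 (h0 ▸ hP))
  set z := (C.ln h ⬝ᵥ C.pt P)⁻¹ * (C.ln h ⬝ᵥ C.pt O) with hz
  obtain ⟨y, hy⟩ := C.eq_mul_of_mem hgh hQ hhQ (v := C.pt O - fun i => C.pt P i * z)
    (by rw [dotProduct_sub, dotProduct_mul_right, (C.incident_iff _ _).1 hO,
      (C.incident_iff _ _).1 hP, zero_mul, sub_zero])
    (by rw [dotProduct_sub, dotProduct_mul_right, hz, mul_inv_cancel_left₀ hhP, sub_self])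
  refine ⟨z, y, ?_⟩
  rw [sub_eq_iff_eq_add'] at hy
  exact hy

/-- Triangles in perspective from a point are in perspective from a line. -/
theorem exists_axis (C : HomogeneousCoordinates K I) {A A' : Fin 3 → Pt} {a a' c : Fin 3 → Ln}
    {X : Fin 3 → Pt} (hA : Function.Injective A) (hA' : Function.Injective A')
    (ha : ∀ i j, i ≠ j → I (A j) (a i)) (ha' : ∀ i j, i ≠ j → I (A' j) (a' i))
    (hAA : ∀ i, A i ≠ A' i) (haa : ∀ i, a i ≠ a' i)
    (hc : ∀ i, I (A i) (c i) ∧ I (A' i) (c i)) (hX : ∀ i, I (X i) (a i) ∧ I (X i) (a' i))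
    (hO : ∃ O, ∀ i, I O (c i)) : ∃ l, ∀ i, I (X i) l := by
  obtain ⟨O, hO⟩ := hO
  choose x y hxy using fun i => C.exists_eq_mul_add_mul (hAA i) (hc i).1 (hc i).2 (hO i)
  have hxy' : ∀ i m, C.pt O m = C.pt (A i) m * x i + C.pt (A' i) m * y i :=
    fun i m => congrFun (hxy i) m
  have cancel : ∀ {P Q : Pt} {z w : K}, P ≠ Q → (∀ m, C.pt P m * z = C.pt Q m * w) → z = 0 := by
    intro P Q z w hPQ h
    by_contra hz
    refine hPQ (C.pt_inj P Q (w * z⁻¹) (funext fun m => ?_))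
    rw [← mul_assoc, ← h, mul_inv_cancel_right₀ hz]
  -- Comparing two expressions of the centre gives `A_i x_i - A_j x_j = A'_j y_j - A'_i y_i`. The
  -- left side lies on the side `a k` and the right side on `a' k`, so the vector is a multiple of
  -- `X k`.
  have key : ∀ i j k, i ≠ j → i ≠ k → j ≠ k → ∃ z, z ≠ 0 ∧
      (fun m => C.pt (A i) m * x i) - (fun m => C.pt (A j) m * x j) =
        fun m => C.pt (X k) m * z := by
    intro i j k hij hik hjk
    have hd : (fun m => C.pt (A i) m * x i) - (fun m => C.pt (A j) m * x j) =
        (fun m => C.pt (A' j) m * y j) - (fun m => C.pt (A' i) m * y i) := by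
      funext m
      rw [Pi.sub_apply, Pi.sub_apply, sub_eq_sub_iff_add_eq_add, ← hxy' i m, add_comm, ← hxy' j m]
    have on_line : ∀ (B : Fin 3 → Pt) (b : Ln) (w : Fin 3 → K), I (B i) b → I (B j) b →
        C.ln b ⬝ᵥ ((fun m => C.pt (B i) m * w i) - (fun m => C.pt (B j) m * w j)) = 0 := by
      intro B b w hi hj
      rw [dotProduct_sub, dotProduct_mul_right, dotProduct_mul_right, (C.incident_iff _ _).1 hi,
        (C.incident_iff _ _).1 hj, zero_mul, zero_mul, sub_self]
    obtain ⟨z, hz⟩ := C.eq_mul_of_mem (haa k) (hX k).1 (hX k).2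
      (on_line A (a k) x (ha k i hik.symm) (ha k j hjk.symm)) (by
        rw [hd, ← neg_sub, dotProduct_neg,
          on_line A' (a' k) y (ha' k i hik.symm) (ha' k j hjk.symm), neg_zero])
    refine ⟨z, ?_, hz⟩
    -- If the factor were 0, distinctness of the vertices in each triangle would force `x i = y i =
    -- 0`, and the centre would have zero coordinates.
    rintro rfl
    have h0 : (fun m => C.pt (A i) m * x i) - (fun m => C.pt (A j) m * x j) = 0 := by
      rw [hz]
      exact funext fun m => mul_zero _
    have hxi : x i = 0 := cancel (hA.ne hij) fun m => congrFun (sub_eq_zero.1 h0) m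
    rw [h0, eq_comm, sub_eq_zero] at hd
    have hyi : y i = 0 := cancel (hA'.ne hij) fun m => (congrFun hd m).symm
    exact C.pt_ne_zero O (funext fun m => by simp [hxy' i m, hxi, hyi])
  obtain ⟨l, hl₀, hl₁⟩ := C.exists_line (X 0) (X 1)
  obtain ⟨z₀, -, h₀⟩ := key 1 2 0 (by decide) (by decide) (by decide)
  obtain ⟨z₁, -, h₁⟩ := key 2 0 1 (by decide) (by decide) (by decide)
  obtain ⟨z₂, hz₂, h₂⟩ := key 0 1 2 (by decide) (by decide) (by decide)
  -- The three cyclic differences add up to zero, so the points `X i` are linearly dependent.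
  have hsum : (fun m => C.pt (X 2) m * z₂) =
      -((fun m => C.pt (X 0) m * z₀) + (fun m => C.pt (X 1) m * z₁)) := by
    rw [← h₀, ← h₁, ← h₂]
    abel
  have hl₂ : I (X 2) l := by
    have := congrArg (fun v => C.ln l ⬝ᵥ v) hsum
    simp only [dotProduct_neg, dotProduct_add, dotProduct_mul_right,
      (C.incident_iff _ _).1 hl₀, (C.incident_iff _ _).1 hl₁, zero_mul, add_zero, neg_zero] at this
    exact (C.incident_iff _ _).2 ((mul_eq_zero.1 this).resolve_right hz₂)
  refine ⟨l, fun i => ?_⟩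
  fin_cases i
  exacts [hl₀, hl₁, hl₂]

theorem injective_vertices (C : HomogeneousCoordinates K I) {A : Fin 3 → Pt}
    (hA : ¬ Collinear I (A 0) (A 1) (A 2)) : Function.Injective A := by
  have h01 : A 0 ≠ A 1 := fun h => hA (by
    obtain ⟨g, h₁, h₂⟩ := C.exists_line (A 1) (A 2)
    exact ⟨g, h ▸ h₁, h₁, h₂⟩)
  have h02 : A 0 ≠ A 2 := fun h => hA (by
    obtain ⟨g, h₁, h₂⟩ := C.exists_line (A 1) (A 2)
    exact ⟨g, h ▸ h₂, h₁, h₂⟩)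
  have h12 : A 1 ≠ A 2 := fun h => hA (by
    obtain ⟨g, h₁, h₂⟩ := C.exists_line (A 0) (A 1)
    exact ⟨g, h₁, h₂, h ▸ h₂⟩)
  intro i j hij
  fin_cases i <;> fin_cases j
  exacts [rfl, (h01 hij).elim, (h02 hij).elim, (h01 hij.symm).elim, rfl, (h12 hij).elim,
    (h02 hij.symm).elim, (h12 hij.symm).elim, rfl]

theorem injective_sides {A : Fin 3 → Pt} {a : Fin 3 → Ln}
    (hA : ¬ Collinear I (A 0) (A 1) (A 2)) (ha : ∀ i j, i ≠ j → I (A j) (a i)) :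
    Function.Injective a := by
  intro i j hij
  by_contra hne
  have hall : ∀ k, I (A k) (a i) := fun k => by
    by_cases hk : i = k
    · rw [hij]
      exact ha j k fun h => hne (hk.trans h.symm)
    · exact ha i k hk
  exact hA ⟨a i, hall 0, hall 1, hall 2⟩

theorem desargues (C : HomogeneousCoordinates K I) : Desargues I := by
  intro A A' a a' c X hA hA' ha ha' hAA haa hc hX
  constructor
  · exact C.exists_axis (C.injective_vertices hA) (C.injective_vertices hA') ha ha' hAA haa hc hX
  -- The converse is the direct statement for the dual: vertices and sides change places, as do the
  -- lines `c` and the points `X`.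
  · exact C.dual.exists_axis (injective_sides hA ha) (injective_sides hA' ha')
      (fun i j h => ha j i h.symm) (fun i j h => ha' j i h.symm) haa hAA hX hc

end HomogeneousCoordinates

end PlaneGeometry

namespace CoordPlane

open PlaneGeometry

variable {K : Type*} [DivisionRing K]

/-! ### Homogeneous coordinates of the extended plane -/

theorem LineEq.dot_smul {u v : LineEq K} {l x y : K} (ha : u.a = l * v.a) (hb : u.b = l * v.b) :
    u.a * x + u.b * y = l * (v.a * x + v.b * y) := by
  rw [ha, hb, mul_add, mul_assoc, mul_assoc]

open Classical in
/-- A direction vector of the line `a x + b y + c = 0`. -/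
noncomputable def LineEq.direction (u : LineEq K) : K × K :=
  if u.a = 0 then (1, 0) else (-(u.a⁻¹ * u.b), 1)

theorem LineEq.direction_ne_zero (u : LineEq K) : u.direction ≠ 0 := by
  rw [direction]
  split_ifs <;> simp

theorem LineEq.dot_direction (u : LineEq K) :
    u.a * u.direction.1 + u.b * u.direction.2 = 0 := by
  rw [direction]
  split_ifs with h
  · simp [h]
  · simp [h]

theorem LineEq.eq_direction_mul {u : LineEq K} {x y : K} (h : u.a * x + u.b * y = 0) :
    ∃ z, x = u.direction.1 * z ∧ y = u.direction.2 * z := by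
  rw [direction]
  split_ifs with ha
  · have hb := u.ne.resolve_left (not_not.2 ha)
    rw [ha, zero_mul, zero_add] at h
    exact ⟨x, by simp, by simpa using (mul_eq_zero.1 h).resolve_left hb⟩
  · refine ⟨y, ?_, by simp⟩
    rw [neg_mul, mul_assoc, ← mul_neg, ← eq_neg_of_add_eq_zero_left h, inv_mul_cancel_left₀ ha]

/-- Orthogonality to a direction vector determines `(a, b)` up to a left factor, so incidence with
an improper point can be tested by a dot product. -/
theorem LineEq.dot_direction_eq_zero_iff {u v : LineEq K} :
    v.a * u.direction.1 + v.b * u.direction.2 = 0 ↔ LineEq.sameDirection K v u := by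
  constructor
  · intro h
    rw [direction] at h
    split_ifs at h with ha
    · have hb := u.ne.resolve_left (not_not.2 ha)
      refine ⟨v.b * (u.b)⁻¹, ?_, by rw [inv_mul_cancel_right₀ hb]⟩
      rw [ha, mul_zero]
      simpa using h
    · refine ⟨v.a * (u.a)⁻¹, by rw [inv_mul_cancel_right₀ ha], ?_⟩
      rw [mul_assoc]
      simpa [neg_add_eq_zero, eq_comm] using h
  · rintro ⟨l, ha, hb⟩
    rw [dot_smul ha hb, dot_direction, mul_zero]

/-- An equation of a line. -/
noncomputable def Line.eqn (g : Line K) : LineEq K := Quotient.out (s := LineEq.sameLine K) g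

theorem Line.mk_eqn (g : Line K) : Line.mk g.eqn.a g.eqn.b g.eqn.c g.eqn.ne = g :=
  Quotient.out_eq (s := LineEq.sameLine K) g

theorem Line.exists_mk (g : Line K) : ∃ a b c h, g = Line.mk a b c h := ⟨_, _, _, _, g.mk_eqn.symm⟩

theorem lies_mk {P : K × K} {a b c : K} {h : a ≠ 0 ∨ b ≠ 0} :
    Lies P (Line.mk a b c h) ↔ a * P.1 + b * P.2 + c = 0 := Iff.rfl

theorem improper_mk_eq_iff {a b c a' b' c' : K} {h : a ≠ 0 ∨ b ≠ 0} {h' : a' ≠ 0 ∨ b' ≠ 0} :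
    (Line.mk a b c h).improper = (Line.mk a' b' c' h').improper ↔
      ∃ l, a = l * a' ∧ b = l * b' :=
  Quotient.eq (r := LineEq.sameDirection K)

theorem mk_eq_iff {a b c a' b' c' : K} {h : a ≠ 0 ∨ b ≠ 0} {h' : a' ≠ 0 ∨ b' ≠ 0} :
    Line.mk a b c h = Line.mk a' b' c' h' ↔ ∃ l, a = l * a' ∧ b = l * b' ∧ c = l * c' :=
  Quotient.eq (r := LineEq.sameLine K)

theorem lies_iff_eqn {P : K × K} {g : Line K} :
    Lies P g ↔ g.eqn.a * P.1 + g.eqn.b * P.2 + g.eqn.c = 0 := by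
  conv_lhs => rw [← g.mk_eqn]
  exact lies_mk

/-- An equation of a line of a parallel class. -/
noncomputable def ImproperPoint.eqn (d : ImproperPoint K) : LineEq K :=
  Quotient.out (s := LineEq.sameDirection K) d

theorem ImproperPoint.mk_eqn (d : ImproperPoint K) :
    Quotient.mk (LineEq.sameDirection K) d.eqn = d :=
  Quotient.out_eq (s := LineEq.sameDirection K) d

theorem improper_eq_iff_eqn {g : Line K} {d : ImproperPoint K} :
    g.improper = d ↔ LineEq.sameDirection K g.eqn d.eqn := by
  conv_lhs => rw [← g.mk_eqn, ← d.mk_eqn]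
  exact Quotient.eq (r := LineEq.sameDirection K)

/-- The coordinate vector of a point. -/
noncomputable def ExtPoint.vec : ExtPoint K → Fin 3 → K
  | .proper P => ![P.1, P.2, 1]
  | .improper d => ![d.eqn.direction.1, d.eqn.direction.2, 0]

/-- The coordinate vector of a line. -/
noncomputable def ExtLine.vec : ExtLine K → Fin 3 → K
  | .proper g => ![g.eqn.a, g.eqn.b, g.eqn.c]
  | .infinity => ![0, 0, 1]

theorem ExtPoint.vec_ne_zero (P : ExtPoint K) : P.vec ≠ 0 := by
  intro h
  cases P with
  | proper P => simpa [vec] using congrFun h 2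
  | improper d =>
    exact d.eqn.direction_ne_zero (Prod.ext (by simpa [vec] using congrFun h 0)
      (by simpa [vec] using congrFun h 1))

theorem ExtLine.vec_ne_zero (g : ExtLine K) : g.vec ≠ 0 := by
  intro h
  cases g with
  | proper g =>
    have h0 := congrFun h 0
    have h1 := congrFun h 1
    simp only [vec, Matrix.cons_val_zero, Matrix.cons_val_one, Pi.zero_apply] at h0 h1
    exact g.eqn.ne.elim (fun h => h h0) (fun h => h h1)
  | infinity => simpa [vec] using congrFun h 2

theorem extLies_iff (P : ExtPoint K) (g : ExtLine K) : ExtLies P g ↔ g.vec ⬝ᵥ P.vec = 0 := by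
  rcases P with P | d <;> rcases g with g | _
  · simp [ExtLies, ExtPoint.vec, ExtLine.vec, lies_iff_eqn, dotProduct, Fin.sum_univ_three]
  · simp [ExtLies, ExtPoint.vec, ExtLine.vec, dotProduct, Fin.sum_univ_three]
  · rw [ExtLies, improper_eq_iff_eqn, ← LineEq.dot_direction_eq_zero_iff]
    simp [ExtPoint.vec, ExtLine.vec, dotProduct, Fin.sum_univ_three]
  · simp [ExtLies, ExtPoint.vec, ExtLine.vec, dotProduct, Fin.sum_univ_three]

theorem ExtPoint.vec_inj (P Q : ExtPoint K) (x : K) (h : P.vec = fun i => Q.vec i * x) :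
    P = Q := by
  have h0 := congrFun h 0
  have h1 := congrFun h 1
  have h2 := congrFun h 2
  rcases P with P | d <;> rcases Q with Q | e <;> simp [vec] at h0 h1 h2
  · subst h2
    exact congrArg _ (Prod.ext (by simpa using h0) (by simpa using h1))
  · subst h2
    exact (d.eqn.direction_ne_zero (Prod.ext (by simpa using h0) (by simpa using h1))).elim
  · have : LineEq.sameDirection K e.eqn d.eqn := by
      rw [← LineEq.dot_direction_eq_zero_iff, h0, h1, ← mul_assoc, ← mul_assoc, ← add_mul,
        LineEq.dot_direction, zero_mul]
    rw [← d.mk_eqn, ← e.mk_eqn]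
    exact congrArg _ (Quotient.sound (s := LineEq.sameDirection K) this).symm

theorem ExtLine.vec_inj (g h : ExtLine K) (x : K) (hx : g.vec = fun i => x * h.vec i) :
    g = h := by
  have h0 := congrFun hx 0
  have h1 := congrFun hx 1
  have h2 := congrFun hx 2
  rcases g with g | _ <;> rcases h with h | _ <;> simp [vec] at h0 h1 h2
  · rw [← g.mk_eqn, ← h.mk_eqn]
    exact congrArg _ (mk_eq_iff.2 ⟨x, h0, h1, h2⟩)
  · exact (g.eqn.ne.elim (fun h => h h0) (fun h => h h1)).elim
  · have hx : x = 0 := by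
      rcases h.eqn.ne with ha | hb
      · exact h0.resolve_right ha
      · exact h1.resolve_right hb
    simp [hx] at h2
  · rfl

theorem ExtPoint.vec_surj (v : Fin 3 → K) :
    ∃ (P : ExtPoint K) (x : K), v = fun i => P.vec i * x := by
  by_cases h2 : v 2 = 0
  · have hu : ∃ u : LineEq K, u.a * v 0 + u.b * v 1 = 0 := by
      by_cases h1 : v 1 = 0
      · exact ⟨⟨0, 1, 0, Or.inr one_ne_zero⟩, by simp [h1]⟩
      · exact ⟨⟨1, -(v 0 * (v 1)⁻¹), 0, Or.inl one_ne_zero⟩, by simp [h1]⟩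
    obtain ⟨u, hu⟩ := hu
    let d : ImproperPoint K := Quotient.mk (LineEq.sameDirection K) u
    obtain ⟨l, ha, hb⟩ : LineEq.sameDirection K d.eqn u :=
      Quotient.exact (s := LineEq.sameDirection K) d.mk_eqn
    obtain ⟨z, h0, h1⟩ := LineEq.eq_direction_mul (u := d.eqn) (x := v 0) (y := v 1)
      (by rw [LineEq.dot_smul ha hb, hu, mul_zero])
    refine ⟨.improper d, z, ?_⟩
    funext i
    fin_cases i
    exacts [h0, h1, by simpa [vec] using h2]
  · refine ⟨.proper (v 0 * (v 2)⁻¹, v 1 * (v 2)⁻¹), v 2, ?_⟩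
    funext i
    fin_cases i <;> simp [vec, h2]

theorem ExtLine.vec_surj (v : Fin 3 → K) :
    ∃ (g : ExtLine K) (x : K), v = fun i => x * g.vec i := by
  by_cases h : v 0 ≠ 0 ∨ v 1 ≠ 0
  · let g : Line K := Line.mk (v 0) (v 1) (v 2) h
    obtain ⟨x, h0, h1, h2⟩ := mk_eq_iff.1 g.mk_eqn.symm
    refine ⟨.proper g, x, ?_⟩
    funext i
    fin_cases i
    exacts [h0, h1, h2]
  · push Not at h
    refine ⟨.infinity, v 2, ?_⟩
    funext i
    fin_cases i <;> simp [vec, h.1, h.2]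

variable (K) in
/-- The homogeneous coordinates of the extended plane. -/
noncomputable def extCoordinates : HomogeneousCoordinates K (ExtLies (K := K)) where
  pt := ExtPoint.vec
  ln := ExtLine.vec
  pt_ne_zero := ExtPoint.vec_ne_zero
  ln_ne_zero := ExtLine.vec_ne_zero
  incident_iff := extLies_iff
  pt_inj := ExtPoint.vec_inj
  ln_inj := ExtLine.vec_inj
  pt_surj v _ := ExtPoint.vec_surj v
  ln_surj v _ := ExtLine.vec_surj v

/-! ### Incidence and parallels -/

theorem collinear_proper_iff {P Q R : K × K} :
    Collinear ExtLies (.proper P) (.proper Q) (.proper R) ↔ Collinear Lies P Q R := by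
  constructor
  · rintro ⟨g | _, hP, hQ, hR⟩
    · exact ⟨g, hP, hQ, hR⟩
    · exact hP.elim
  · rintro ⟨g, h⟩
    exact ⟨.proper g, h⟩

theorem not_collinear_of_lies {P Q R : K × K} {g : Line K} (hPQ : P ≠ Q) (hP : Lies P g)
    (hQ : Lies Q g) (hR : ¬ Lies R g) : ¬ Collinear Lies P Q R := by
  rintro ⟨h, hP', hQ', hR'⟩
  have : ExtLine.proper g = .proper h := (extCoordinates K).line_unique
    (P := .proper P) (Q := .proper Q) (fun h => hPQ (ExtPoint.proper.inj h)) hP hQ hP' hQ'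
  exact hR (ExtLine.proper.inj this ▸ hR')

theorem projectiveIncidence : ProjectiveIncidence (ExtLies (K := K)) where
  line A B hAB := by
    obtain ⟨g, hA, hB⟩ := (extCoordinates K).exists_line A B
    exact ⟨g, ⟨hA, hB⟩, fun h hh => (extCoordinates K).line_unique hAB hh.1 hh.2 hA hB⟩
  point g h hgh := by
    obtain ⟨A, hg, hh⟩ := (extCoordinates K).exists_point g h
    exact ⟨A, ⟨hg, hh⟩, fun B hB => (extCoordinates K).point_unique hgh hB.1 hB.2 hg hh⟩
  quadrangle := by
    refine ⟨.proper (0, 0), .proper (1, 0), .proper (0, 1), .proper (1, 1), ?_, ?_, ?_, ?_⟩ <;>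
      rw [collinear_proper_iff]
    · exact not_collinear_of_lies (g := Line.mk 0 1 0 (Or.inr one_ne_zero)) (by simp)
        (by simp [lies_mk]) (by simp [lies_mk]) (by simp [lies_mk])
    · exact not_collinear_of_lies (g := Line.mk 0 1 0 (Or.inr one_ne_zero)) (by simp)
        (by simp [lies_mk]) (by simp [lies_mk]) (by simp [lies_mk])
    · exact not_collinear_of_lies (g := Line.mk 1 0 0 (Or.inl one_ne_zero)) (by simp)
        (by simp [lies_mk]) (by simp [lies_mk]) (by simp [lies_mk])
    · exact not_collinear_of_lies (g := Line.mk 1 1 (-1) (Or.inl one_ne_zero)) (by simp)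
        (by simp [lies_mk]) (by simp [lies_mk]) (by simp [lies_mk])

theorem incidenceAxioms : IncidenceAxioms (Lies (K := K)) where
  exists_line A B _ := by
    obtain ⟨g | _, hA, hB⟩ := (extCoordinates K).exists_line (.proper A) (.proper B)
    · exact ⟨g, hA, hB⟩
    · exact hA.elim
  line_unique A B g h hAB hAg hBg hAh hBh := ExtLine.proper.inj
    ((extCoordinates K).line_unique (P := .proper A) (Q := .proper B)
      (fun h => hAB (ExtPoint.proper.inj h)) hAg hBg hAh hBh)
  two_points g := by
    obtain ⟨a, b, c, h, rfl⟩ := g.exists_mk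
    by_cases ha : a = 0
    · have hb := h.resolve_left (not_not.2 ha)
      exact ⟨(0, -(b⁻¹ * c)), (1, -(b⁻¹ * c)), by simp, by simp [lies_mk, hb],
        by simp [lies_mk, ha, hb]⟩
    · exact ⟨(-(a⁻¹ * c), 0), (-(a⁻¹ * (b + c)), 1), by simp, by simp [lies_mk, ha],
        by simp [lies_mk, ha]⟩
  three_points := ⟨(0, 0), (1, 0), (0, 1), by simp, by simp, by simp,
    not_collinear_of_lies (g := Line.mk 0 1 0 (Or.inr one_ne_zero)) (by simp)
        (by simp [lies_mk]) (by simp [lies_mk]) (by simp [lies_mk])⟩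

/-- Otherwise two distinct lines would share a proper and an improper point. -/
theorem improper_ne_of_lies {P : K × K} {g h : Line K} (hgh : g ≠ h) (hg : Lies P g)
    (hh : Lies P h) : g.improper ≠ h.improper := fun heq => by
  have := (extCoordinates K).point_unique (P := .proper P) (Q := .improper h.improper)
    (g := .proper g) (h := .proper h) (fun h => hgh (ExtLine.proper.inj h)) hg hh heq rfl
  cases this

theorem exists_lies_of_improper_ne {g h : Line K} (hgh : g.improper ≠ h.improper) :
    ∃ P, Lies P g ∧ Lies P h := by
  obtain ⟨P | d, hg, hh⟩ := (extCoordinates K).exists_point (.proper g) (.proper h)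
  · exact ⟨P, hg, hh⟩
  · exact (hgh (Eq.trans hg (Eq.symm hh))).elim

theorem parallel_iff {g h : Line K} (hgh : g ≠ h) :
    Parallel g h ↔ ¬ ∃ P, Lies P g ∧ Lies P h := by
  constructor
  · rintro ⟨-, hd⟩ ⟨P, hg, hh⟩
    exact improper_ne_of_lies hgh hg hh hd
  · intro h0
    exact ⟨hgh, by_contra fun hd => h0 (exists_lies_of_improper_ne hd)⟩

theorem parallelPostulate : ParallelPostulate (Lies (K := K)) := by
  intro P g hP
  -- The parallel through `P` is the line joining `P` to the improper point of `g`; its uniqueness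
  -- is that of the joining line.
  obtain ⟨h | _, hPh, hd⟩ :=
    (extCoordinates K).exists_line (.proper P) (.improper g.improper)
  swap
  · exact hPh.elim
  have ne_of : ∀ {k : Line K}, Lies P k → g ≠ k := fun hk hgk => hP (hgk ▸ hk)
  refine ⟨h, ⟨hPh, fun Q hQ => improper_ne_of_lies (ne_of hPh) hQ.1 hQ.2 (Eq.symm hd)⟩, ?_⟩
  rintro k ⟨hPk, hk⟩
  have hpar := (parallel_iff (ne_of hPk)).2 fun ⟨Q, hQ⟩ => hk Q hQ
  exact ExtLine.proper.inj ((extCoordinates K).line_unique (P := .proper P)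
    (Q := .improper g.improper) (fun h => by cases h) hPk hpar.2.symm hPh hd)

/-! ### Order -/

theorem fst_eq_of_collinear {P Q R : K × K} (h : Collinear Lies P Q R) (hPQ : P ≠ Q)
    (h₁ : P.1 = Q.1) : R.1 = P.1 := by
  have h' := mt (not_collinear_of_lies (R := R)
    (g := Line.mk 1 0 (-P.1) (Or.inl one_ne_zero)) hPQ (by simp [lies_mk]) (by simp [lies_mk, h₁]))
    (not_not.2 h)
  rw [not_not, lies_mk] at h'
  simpa [← sub_eq_add_neg, sub_eq_zero] using h'

/-- The value of the left-hand side of an equation is affine on each line. -/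
theorem eval_add_mul (a b c : K) (P Q : K × K) (r : K) :
    a * (P.1 + (Q.1 - P.1) * r) + b * (P.2 + (Q.2 - P.2) * r) + c =
      (a * P.1 + b * P.2 + c) * (1 - r) + (a * Q.1 + b * Q.2 + c) * r := by
  noncomm_ring

theorem lies_add_mul {P Q : K × K} {g : Line K} (hP : Lies P g) (hQ : Lies Q g) (r : K) :
    Lies (P.1 + (Q.1 - P.1) * r, P.2 + (Q.2 - P.2) * r) g := by
  obtain ⟨a, b, c, h, rfl⟩ := g.exists_mk
  rw [lies_mk] at *
  rw [eval_add_mul, hP, hQ, zero_mul, zero_mul, add_zero]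

/-! ### Betweenness in a linear order. -/

section NumBetween

variable {K : Type*} [LinearOrder K]

theorem NumBetween.symm {x y z : K} (h : NumBetween x y z) : NumBetween z y x :=
  h.elim (fun h => Or.inr ⟨h.2, h.1⟩) (fun h => Or.inl ⟨h.2, h.1⟩)

theorem NumBetween.ne {x y z : K} (h : NumBetween x y z) : x ≠ y ∧ x ≠ z ∧ y ≠ z :=
  h.elim (fun h => ⟨h.1.ne, (h.1.trans h.2).ne, h.2.ne⟩)
    (fun h => ⟨h.1.ne', (h.2.trans h.1).ne', h.2.ne'⟩)

theorem NumBetween.not_rotate {x y z : K} (h : NumBetween x y z) : ¬ NumBetween y z x := by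
  rintro (h' | h') <;> rcases h with h | h
  · exact lt_asymm (h.1.trans h.2) h'.2
  · exact lt_asymm h.2 h'.1
  · exact lt_asymm h.2 h'.1
  · exact lt_asymm (h.2.trans h.1) h'.2

theorem numBetween_total {x y z : K} (hxy : x ≠ y) (hxz : x ≠ z) (hyz : y ≠ z) :
    NumBetween x y z ∨ NumBetween y z x ∨ NumBetween z x y := by
  simp only [NumBetween]
  rcases hxy.lt_or_gt with h₁ | h₁ <;> rcases hxz.lt_or_gt with h₂ | h₂ <;>
    rcases hyz.lt_or_gt with h₃ | h₃ <;> tauto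

end NumBetween

/-! ### Segments, sides of a line and the order axioms. -/

section Order

variable [LinearOrder K]

theorem Between.symm {P Q R : K × K} (h : Between P Q R) : Between R Q P := by
  obtain ⟨⟨g, hP, hQ, hR⟩, h⟩ := h
  exact ⟨⟨g, hR, hQ, hP⟩, h.imp NumBetween.symm fun h => ⟨h.2.1.symm, h.1.symm, h.2.2.symm⟩⟩

variable [IsStrictOrderedRing K]

theorem NumBetween.exists_eq {x y z : K} (h : NumBetween x y z) :
    ∃ r, 0 < r ∧ r < 1 ∧ y = x + (z - x) * r := by
  have hxz : x ≠ z := by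
    rcases h with h | h
    · exact (h.1.trans h.2).ne
    · exact (h.2.trans h.1).ne'
  have hne := sub_ne_zero.2 hxz.symm
  -- The parameter stands to the right of `z - x`, so the inverse must be multiplied from the left.
  refine ⟨(z - x)⁻¹ * (y - x), ?_, ?_, by rw [mul_inv_cancel_left₀ hne, add_sub_cancel]⟩
  · rcases h with h | h
    · exact mul_pos (inv_pos.2 (sub_pos.2 (h.1.trans h.2))) (sub_pos.2 h.1)
    · exact mul_pos_of_neg_of_neg (inv_lt_zero.2 (sub_neg.2 (h.2.trans h.1))) (sub_neg.2 h.1)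
  · rw [← sub_pos, ← inv_mul_cancel₀ hne, ← mul_sub, sub_sub_sub_cancel_right]
    rcases h with h | h
    · exact mul_pos (inv_pos.2 (sub_pos.2 (h.1.trans h.2))) (sub_pos.2 h.2)
    · exact mul_pos_of_neg_of_neg (inv_lt_zero.2 (sub_neg.2 (h.2.trans h.1))) (sub_neg.2 h.2)

theorem numBetween_add_mul {x z r : K} (hxz : x ≠ z) (h₀ : 0 < r) (h₁ : r < 1) :
    NumBetween x (x + (z - x) * r) z := by
  have hz : z - (x + (z - x) * r) = (z - x) * (1 - r) := by rw [mul_sub, mul_one]; abel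
  rcases hxz.lt_or_gt with h | h
  · refine Or.inl ⟨lt_add_of_pos_right _ (mul_pos (sub_pos.2 h) h₀), ?_⟩
    rw [← sub_pos, hz]
    exact mul_pos (sub_pos.2 h) (sub_pos.2 h₁)
  · refine Or.inr ⟨add_lt_of_neg_right _ (mul_neg_of_neg_of_pos (sub_neg.2 h) h₀), ?_⟩
    rw [gt_iff_lt, ← sub_neg, hz]
    exact mul_neg_of_neg_of_pos (sub_neg.2 h) (sub_pos.2 h₁)

theorem Between.exists_eq {P X Q : K × K} (h : Between P X Q) :
    ∃ r, 0 < r ∧ r < 1 ∧ X = (P.1 + (Q.1 - P.1) * r, P.2 + (Q.2 - P.2) * r) := by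
  obtain ⟨⟨g, hP, hX, hQ⟩, h | ⟨h₁, h₂, h⟩⟩ := h
  · obtain ⟨r, h₀, h₁, hr⟩ := h.exists_eq
    refine ⟨r, h₀, h₁, ?_⟩
    -- The parametrised point has the same abscissa as `X`. Were the two different, their line would
    -- be parallel to the `y`-axis and `P` would have that abscissa too.
    by_contra hne
    have := fst_eq_of_collinear (R := P) ⟨g, hX, lies_add_mul hP hQ r, hP⟩ hne hr
    exact h.ne.1 this
  · obtain ⟨r, h₀, h₃, hr⟩ := h.exists_eq
    exact ⟨r, h₀, h₃, Prod.ext (by simp [← h₂, ← h₁]) hr⟩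

theorem between_add_mul {P Q : K × K} (hPQ : P ≠ Q) {r : K} (h₀ : 0 < r) (h₁ : r < 1) :
    Between P (P.1 + (Q.1 - P.1) * r, P.2 + (Q.2 - P.2) * r) Q := by
  obtain ⟨g, hP, hQ⟩ := incidenceAxioms.exists_line P Q hPQ
  refine ⟨⟨g, hP, lies_add_mul hP hQ r, hQ⟩, ?_⟩
  by_cases h : P.1 = Q.1
  · exact Or.inr ⟨by simp [h], by simp [h],
      numBetween_add_mul (fun h' => hPQ (Prod.ext h h')) h₀ h₁⟩
  · exact Or.inl (numBetween_add_mul h h₀ h₁)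

/-- A line separates two points if and only if they are on different sides of it. -/
theorem exists_between_iff {a b c : K} {h : a ≠ 0 ∨ b ≠ 0} {P Q : K × K}
    (hP : a * P.1 + b * P.2 + c ≠ 0) (hQ : a * Q.1 + b * Q.2 + c ≠ 0) :
    (∃ X, Lies X (Line.mk a b c h) ∧ Between P X Q) ↔
      ¬ (0 < a * P.1 + b * P.2 + c ↔ 0 < a * Q.1 + b * Q.2 + c) := by
  constructor
  · rintro ⟨X, hX, hPXQ⟩ hiff
    obtain ⟨r, h₀, h₁, rfl⟩ := hPXQ.exists_eq
    rw [lies_mk, eval_add_mul] at hX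
    have h₁' := sub_pos.2 h₁
    rcases hP.lt_or_gt with hlt | hgt
    · have hQ' := hQ.lt_or_gt.resolve_right fun hQ' => lt_asymm hlt (hiff.2 hQ')
      exact (add_neg (mul_neg_of_neg_of_pos hlt h₁') (mul_neg_of_neg_of_pos hQ' h₀)).ne hX
    · exact (add_pos (mul_pos hgt h₁') (mul_pos (hiff.1 hgt) h₀)).ne' hX
  · have main : ∀ {P Q : K × K}, a * P.1 + b * P.2 + c < 0 → 0 < a * Q.1 + b * Q.2 + c →
        ∃ X, Lies X (Line.mk a b c h) ∧ Between P X Q := by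
      intro P Q hP hQ
      -- As 0 lies between the values at `P` and `Q`, the affine parameter at which the value
      -- vanishes lies strictly between 0 and 1.
      obtain ⟨r, h₀, h₁, hr⟩ := NumBetween.exists_eq (Or.inl ⟨hP, hQ⟩)
      refine ⟨(P.1 + (Q.1 - P.1) * r, P.2 + (Q.2 - P.2) * r), ?_, between_add_mul ?_ h₀ h₁⟩
      · rw [lies_mk, eval_add_mul, hr]
        noncomm_ring
      · rintro rfl
        exact lt_asymm hP hQ
    intro hiff
    rcases hP.lt_or_gt with hP' | hP' <;> rcases hQ.lt_or_gt with hQ' | hQ'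
    · exact (hiff (iff_of_false hP'.not_gt hQ'.not_gt)).elim
    · exact main hP' hQ'
    · obtain ⟨X, hX, hB⟩ := main hQ' hP'
      exact ⟨X, hX, hB.symm⟩
    · exact (hiff (iff_of_true hP' hQ')).elim

theorem orderAxioms : OrderAxioms (Lies (K := K)) Between where
  between_distinct P Q R h := by
    rcases h.2 with h | ⟨-, -, h⟩
    · exact ⟨fun e => h.ne.1 (congrArg _ e), fun e => h.ne.2.1 (congrArg _ e),
        fun e => h.ne.2.2 (congrArg _ e)⟩
    · exact ⟨fun e => h.ne.1 (congrArg _ e), fun e => h.ne.2.1 (congrArg _ e),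
        fun e => h.ne.2.2 (congrArg _ e)⟩
  between_collinear P Q R h := h.1
  between_symm P Q R h := h.symm
  extend P Q hPQ := by
    obtain ⟨g, hP, hQ⟩ := incidenceAxioms.exists_line P Q hPQ
    have two : ∀ {x y : K}, x ≠ y → NumBetween x y (x + (y - x) * 2) := fun {x y} hxy => by
      have e : x + (y - x) * 2 = y + (y - x) := by rw [mul_two]; abel
      rw [e]
      exact hxy.lt_or_gt.imp (fun h => ⟨h, lt_add_of_pos_right _ (sub_pos.2 h)⟩)
        (fun h => ⟨h, add_lt_of_neg_right _ (sub_neg.2 h)⟩)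
    -- Parameter 2 gives the reflection of `P` in `Q`.
    refine ⟨_, ⟨g, hP, hQ, lies_add_mul hP hQ 2⟩, ?_⟩
    by_cases h : P.1 = Q.1
    · exact Or.inr ⟨h, by simp [h], two fun h' => hPQ (Prod.ext h h')⟩
    · exact Or.inl (two h)
  exists_between P Q R hPQ hPR hQR hcol := by
    obtain ⟨g, hP, hQ, hR⟩ := hcol
    by_cases h : P.1 = Q.1
    · have h' := fst_eq_of_collinear ⟨g, hP, hQ, hR⟩ hPQ h
      refine (numBetween_total (x := P.2) (y := Q.2) (z := R.2) (fun e => hPQ (Prod.ext h e))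
        (fun e => hPR (Prod.ext h'.symm e)) (fun e => hQR (Prod.ext (h.symm.trans h'.symm) e))).imp
        (fun hb => ⟨⟨g, hP, hQ, hR⟩, Or.inr ⟨h, h.symm.trans h'.symm, hb⟩⟩)
        (Or.imp (fun hb => ⟨⟨g, hQ, hR, hP⟩, Or.inr ⟨h.symm.trans h'.symm, h', hb⟩⟩)
          (fun hb => ⟨⟨g, hR, hP, hQ⟩, Or.inr ⟨h', h, hb⟩⟩))
    · refine (numBetween_total (x := P.1) (y := Q.1) (z := R.1) h
        (fun e => h (fst_eq_of_collinear ⟨g, hP, hR, hQ⟩ hPR e).symm)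
        (fun e => h (fst_eq_of_collinear ⟨g, hQ, hR, hP⟩ hQR e))).imp
        (fun hb => ⟨⟨g, hP, hQ, hR⟩, Or.inl hb⟩)
        (Or.imp (fun hb => ⟨⟨g, hQ, hR, hP⟩, Or.inl hb⟩)
          (fun hb => ⟨⟨g, hR, hP, hQ⟩, Or.inl hb⟩))
  between_unique P Q R h h' := by
    rcases h.2 with h | ⟨e, -, h⟩ <;> rcases h'.2 with h' | ⟨e₁, e₂, h'⟩
    · exact h.not_rotate h'
    · exact h.ne.2.2 e₁
    · exact h'.ne.2.1 e.symm
    · exact h.not_rotate h'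
  pasch P Q R g _ hP hQ hR hX := by
    obtain ⟨a, b, c, h, rfl⟩ := g.exists_mk
    rw [exists_between_iff hP hQ] at hX
    rw [exists_between_iff hP hR, exists_between_iff hQ hR]
    -- If `P` and `Q` have different signs, the sign of `R` differs from one of them.
    tauto

end Order

end CoordPlane

namespace HilbertNumber

open PlaneGeometry CoordPlane

/-! ##:= by
The configuration that refutes Pappus' theorem -/

/-- The `x`-axis. -/
noncomputable def xAxis : Line HilbertNumber := Line.mk 0 1 0 (Or.inr one_ne_zero)

/-- The `y`-axis. -/
noncomputable def yAxis : Line HilbertNumber := Line.mk 1 0 0 (Or.inl one_ne_zero)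

/-- The line `x + b y + c = 0`. -/
noncomputable def unitLine (b c : HilbertNumber) : Line HilbertNumber := Line.mk 1 b c (Or.inl one_ne_zero)

theorem lies_unitLine {b c : HilbertNumber} {P : HilbertNumber × HilbertNumber} :
    Lies P (unitLine b c) ↔ P.1 + b * P.2 + c = 0 := by
  rw [unitLine, lies_mk, one_mul]

theorem improper_unitLine (b c d : HilbertNumber) :
    (unitLine b c).improper = (unitLine b d).improper :=
  improper_mk_eq_iff.2 ⟨1, (one_mul _).symm, (one_mul _).symm⟩

theorem parallel_unitLine {b c d : HilbertNumber} (h : c ≠ d) :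
    Parallel (unitLine b (-c)) (unitLine b (-d)) := by
  refine ⟨fun heq => h (neg_injective ?_), improper_unitLine b _ _⟩
  obtain ⟨l, h₁, -, h₂⟩ := mk_eq_iff.1 heq
  rw [mul_one] at h₁
  rw [h₂, ← h₁, one_mul]

theorem pappusHexagon : PappusHexagon Lies xAxis yAxis
    (s * t, 0) (0, t) (t, 0) (0, 1) (s, 0) (0, s) where
  lines_ne h := by
    obtain ⟨l, -, h, -⟩ := mk_eq_iff.1 h
    simp at h
  on_g := by simp [xAxis, lies_mk]
  on_h := by simp [yAxis, lies_mk]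
  not_on_h := by simp [yAxis, lies_mk, s_ne_zero, t_ne_zero]
  not_on_g := by simp [xAxis, lies_mk, s_ne_zero, t_ne_zero]
  ne_on_g := by
    refine ⟨fun h => ?_, fun h => ?_, fun h => t_lt_s.ne (congrArg Prod.fst h)⟩
    · exact s_lt_one.ne (mul_right_cancel₀ t_ne_zero
        ((congrArg Prod.fst h : s * t = t).trans (one_mul t).symm))
    · exact (t_lt_s.trans s_lt_one).ne (mul_left_cancel₀ s_ne_zero
        ((congrArg Prod.fst h : s * t = s).trans (mul_one s).symm))
  ne_on_h := ⟨fun h => (t_lt_s.trans s_lt_one).ne (congrArg Prod.snd h),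
    fun h => t_lt_s.ne (congrArg Prod.snd h), fun h => s_lt_one.ne' (congrArg Prod.snd h)⟩

theorem s_mul_t_ne_s : s * t ≠ s := fun h => pappusHexagon.ne_on_g.2.1 (Prod.ext h rfl)

theorem t_mul_s_ne_t : t * s ≠ t := fun h =>
  s_lt_one.ne (mul_left_cancel₀ t_ne_zero (h.trans (mul_one t).symm))

theorem lies_unitLine_fst (b c : HilbertNumber) : Lies (c, 0) (unitLine b (-c)) := by
  simp [lies_unitLine]

theorem lies_unitLine_snd (b d : HilbertNumber) : Lies (0, d) (unitLine b (-(b * d))) := by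
  simp [lies_unitLine]

theorem lies_unitLine_snd_one (b : HilbertNumber) : Lies (0, 1) (unitLine b (-b)) := by
  simp [lies_unitLine]

theorem lies_unitLine_one (d : HilbertNumber) : Lies (0, d) (unitLine 1 (-d)) := by
  simp [lies_unitLine]

/-- A line `a x + a t y + d = 0` through both points satisfies `a t s = -d = a s t`. Since `a ≠ 0`,
this would give `ts = st`. -/
theorem improper_ne {m : Line HilbertNumber} (h₆ : Lies (0, s) m) (h₁ : Lies (s * t, 0) m)
    (c : HilbertNumber) : m.improper ≠ (unitLine t c).improper := by
  obtain ⟨a, b, d, h, rfl⟩ := m.exists_mk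
  intro heq
  obtain ⟨l, ha, hb⟩ := improper_mk_eq_iff.1 heq
  rw [mul_one] at ha
  subst ha
  have hl : a ≠ 0 := fun h0 => h.elim (fun h => h h0) (fun h => h (by rw [hb, h0, zero_mul]))
  rw [lies_mk] at h₆ h₁
  simp only [mul_zero, zero_add, add_zero] at h₆ h₁
  have := add_right_cancel (h₆.trans h₁.symm)
  rw [hb, mul_assoc] at this
  exact t_mul_s_ne (mul_left_cancel₀ hl this)

theorem ofReal_zero : ofReal 0 = 0 := by
  ext1
  simp [ofReal]

theorem not_pappus : ¬ Pappus (ExtLies (K := HilbertNumber)) := by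
  intro hP
  have hex := pappusHexagon
  obtain ⟨m, hm₆, hm₁⟩ := incidenceAxioms.exists_line ((0, s) : HilbertNumber × HilbertNumber)
    (s * t, 0) (by simp [s_ne_zero])
  -- The third pair of opposite sides is not parallel, so it meets in a proper point, whereas the
  -- other two pairs meet in improper points.
  obtain ⟨R, hRk, hRm⟩ := exists_lies_of_improper_ne (improper_ne hm₆ hm₁ (-t)).symm
  have proper_inj : ∀ {P Q : HilbertNumber × HilbertNumber}, P ≠ Q →
      ExtPoint.proper P ≠ ExtPoint.proper Q := fun h e => h (ExtPoint.proper.inj e)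
  have hex' : PappusHexagon ExtLies (.proper xAxis) (.proper yAxis) (.proper (s * t, 0))
      (.proper (0, t)) (.proper (t, 0)) (.proper (0, 1)) (.proper (s, 0)) (.proper (0, s)) :=
    ⟨fun h => hex.lines_ne (ExtLine.proper.inj h), hex.on_g, hex.on_h, hex.not_on_h, hex.not_on_g,
      hex.ne_on_g.imp proper_inj (And.imp proper_inj proper_inj),
      hex.ne_on_h.imp proper_inj (And.imp proper_inj proper_inj)⟩
  obtain ⟨g | _, h₁, h₂, h₃⟩ := hP _ _ _ _ _ _ _ _ hex'
    (.proper (unitLine s (-(s * t)))) (.proper (unitLine 1 (-t))) (.proper (unitLine t (-t)))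
    (.proper (unitLine s (-s))) (.proper (unitLine 1 (-s))) (.proper m)
    ⟨lies_unitLine_fst _ _, lies_unitLine_snd _ _⟩ ⟨lies_unitLine_one _, lies_unitLine_fst _ _⟩
    ⟨lies_unitLine_fst _ _, lies_unitLine_snd_one _⟩
    ⟨lies_unitLine_snd_one _, lies_unitLine_fst _ _⟩
    ⟨lies_unitLine_fst _ _, lies_unitLine_one _⟩ ⟨hm₆, hm₁⟩
    (.improper (unitLine s 0).improper) (.improper (unitLine 1 0).improper) (.proper R)
    ⟨improper_unitLine _ _ _, improper_unitLine _ _ _⟩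
    ⟨improper_unitLine _ _ _, improper_unitLine _ _ _⟩ ⟨hRk, hRm⟩
  -- A proper line has only one improper point, so the two directions would agree and `s = 1`; the
  -- line at infinity is excluded by the proper point `R`.
  · obtain ⟨l, h₄, h₅⟩ := improper_mk_eq_iff.1 (Eq.trans (Eq.symm h₁) h₂)
    rw [mul_one] at h₄ h₅
    exact s_lt_one.ne (h₅.trans h₄.symm)
  · exact h₃

end HilbertNumber

theorem mainTheorem7 :
    ∃ (_ : DivisionRing HilbertNumber) (_ : LinearOrder HilbertNumber),
      -- the operations and the order are the ones defined on double Laurent series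
      (∀ a b : HilbertNumber, a + b = a.add b) ∧
      (∀ a b : HilbertNumber, a * b = a.mul b) ∧
      (0 : HilbertNumber) = HilbertNumber.ofReal 0 ∧
      (1 : HilbertNumber) = HilbertNumber.ofReal 1 ∧
      (∀ a b : HilbertNumber, a < b ↔ (b.sub a).Pos) ∧
      -- the skew field is linearly ordered, proper and non-Archimedean
      IsStrictOrderedRing HilbertNumber ∧
      HilbertNumber.t * HilbertNumber.s = 2 * (HilbertNumber.s * HilbertNumber.t) ∧
      HilbertNumber.t * HilbertNumber.s ≠ HilbertNumber.s * HilbertNumber.t ∧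
      ¬ Archimedean HilbertNumber ∧
      0 < HilbertNumber.t ∧
      (∀ m : ℕ, m * HilbertNumber.t < HilbertNumber.s) ∧
      (∀ n : ℕ, n * HilbertNumber.s < 1) ∧
      -- the coordinate plane
      PlaneGeometry.IncidenceAxioms (CoordPlane.Lies (K := HilbertNumber)) ∧
      (∀ g h : CoordPlane.Line HilbertNumber, g ≠ h →
        (CoordPlane.Parallel g h ↔ ¬ ∃ P, CoordPlane.Lies P g ∧ CoordPlane.Lies P h)) ∧
      PlaneGeometry.OrderAxioms (CoordPlane.Lies (K := HilbertNumber)) CoordPlane.Between ∧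
      PlaneGeometry.ParallelPostulate (CoordPlane.Lies (K := HilbertNumber)) ∧
      -- the plane with improper points
      PlaneGeometry.ProjectiveIncidence (CoordPlane.ExtLies (K := HilbertNumber)) ∧
      PlaneGeometry.Desargues (CoordPlane.ExtLies (K := HilbertNumber)) ∧
      ¬ PlaneGeometry.Pappus (CoordPlane.ExtLies (K := HilbertNumber)) ∧
      -- the explicit configuration: a hexagon with vertices alternately on the coordinate axes
      (∃ (xAxis yAxis g g' k k' l l' : CoordPlane.Line HilbertNumber)
          (p₁ p₂ p₃ p₄ p₅ p₆ : HilbertNumber × HilbertNumber),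
        xAxis = CoordPlane.Line.mk 0 1 0 (Or.inr one_ne_zero) ∧
        yAxis = CoordPlane.Line.mk 1 0 0 (Or.inl one_ne_zero) ∧
        g = CoordPlane.Line.mk 1 HilbertNumber.s (-HilbertNumber.s) (Or.inl one_ne_zero) ∧
        g' = CoordPlane.Line.mk 1 HilbertNumber.s (-(HilbertNumber.s * HilbertNumber.t))
          (Or.inl one_ne_zero) ∧
        k = CoordPlane.Line.mk 1 HilbertNumber.t (-HilbertNumber.t) (Or.inl one_ne_zero) ∧
        k' = CoordPlane.Line.mk 1 HilbertNumber.t (-(HilbertNumber.t * HilbertNumber.s))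
          (Or.inl one_ne_zero) ∧
        l = CoordPlane.Line.mk 1 1 (-HilbertNumber.s) (Or.inl one_ne_zero) ∧
        l' = CoordPlane.Line.mk 1 1 (-HilbertNumber.t) (Or.inl one_ne_zero) ∧
        p₁ = (HilbertNumber.s * HilbertNumber.t, 0) ∧ p₂ = (0, HilbertNumber.t) ∧
        p₃ = (HilbertNumber.t, 0) ∧ p₄ = (0, 1) ∧
        p₅ = (HilbertNumber.s, 0) ∧ p₆ = (0, HilbertNumber.s) ∧
        PlaneGeometry.PappusHexagon CoordPlane.Lies xAxis yAxis p₁ p₂ p₃ p₄ p₅ p₆ ∧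
        -- the opposite sides `g' = p₁p₂` and `g = p₄p₅` are parallel
        (CoordPlane.Lies p₁ g' ∧ CoordPlane.Lies p₂ g') ∧
        (CoordPlane.Lies p₄ g ∧ CoordPlane.Lies p₅ g) ∧ CoordPlane.Parallel g' g ∧
        -- the opposite sides `l' = p₂p₃` and `l = p₅p₆` are parallel
        (CoordPlane.Lies p₂ l' ∧ CoordPlane.Lies p₃ l') ∧
        (CoordPlane.Lies p₅ l ∧ CoordPlane.Lies p₆ l) ∧ CoordPlane.Parallel l' l ∧
        -- `k = p₃p₄` is parallel to `k'`, which goes through `p₆` and the point `(ts, 0)`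
        (CoordPlane.Lies p₃ k ∧ CoordPlane.Lies p₄ k) ∧ CoordPlane.Parallel k' k ∧
        CoordPlane.Lies p₆ k' ∧ CoordPlane.Lies (HilbertNumber.t * HilbertNumber.s, 0) k' ∧
        -- but the connection of `p₆` and `p₁` is not parallel to `k`
        ∀ m, CoordPlane.Lies p₆ m → CoordPlane.Lies p₁ m → m ≠ k ∧ ¬ CoordPlane.Parallel m k) := by
  open scoped HilbertNumber in
  exact ⟨HilbertNumber.divisionRing, HilbertNumber.linearOrder, fun _ _ => rfl, fun _ _ => rfl,
    HilbertNumber.ofReal_zero.symm, rfl, fun _ _ => Iff.rfl, HilbertNumber.isStrictOrderedRing,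
    HilbertNumber.t_mul_s, HilbertNumber.t_mul_s_ne, HilbertNumber.not_archimedean,
    HilbertNumber.zero_lt_iff_pos.2 HilbertNumber.pos_t, HilbertNumber.nsmul_t_lt_s,
    HilbertNumber.nsmul_s_lt_one, CoordPlane.incidenceAxioms, fun _ _ => CoordPlane.parallel_iff,
    CoordPlane.orderAxioms, CoordPlane.parallelPostulate,
    CoordPlane.projectiveIncidence, (CoordPlane.extCoordinates HilbertNumber).desargues,
    HilbertNumber.not_pappus, HilbertNumber.xAxis, HilbertNumber.yAxis,
    HilbertNumber.unitLine _ _, HilbertNumber.unitLine _ _, HilbertNumber.unitLine _ _,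
    HilbertNumber.unitLine _ _, HilbertNumber.unitLine _ _, HilbertNumber.unitLine _ _,
    _, _, _, _, _, _, rfl, rfl, rfl, rfl, rfl,
    rfl, rfl, rfl, rfl, rfl, rfl, rfl, rfl, rfl, HilbertNumber.pappusHexagon,
    ⟨HilbertNumber.lies_unitLine_fst _ _, HilbertNumber.lies_unitLine_snd _ _⟩,
    ⟨HilbertNumber.lies_unitLine_snd_one _, HilbertNumber.lies_unitLine_fst _ _⟩,
    HilbertNumber.parallel_unitLine HilbertNumber.s_mul_t_ne_s,
    ⟨HilbertNumber.lies_unitLine_one _, HilbertNumber.lies_unitLine_fst _ _⟩,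
    ⟨HilbertNumber.lies_unitLine_fst _ _, HilbertNumber.lies_unitLine_one _⟩,
    HilbertNumber.parallel_unitLine HilbertNumber.t_lt_s.ne,
    ⟨HilbertNumber.lies_unitLine_fst _ _, HilbertNumber.lies_unitLine_snd_one _⟩,
    HilbertNumber.parallel_unitLine HilbertNumber.t_mul_s_ne_t,
    HilbertNumber.lies_unitLine_snd _ _, HilbertNumber.lies_unitLine_fst _ _,
    fun m h₆ h₁ => ⟨fun h => HilbertNumber.improper_ne h₆ h₁ _ (congrArg _ h),
      fun h => HilbertNumber.improper_ne h₆ h₁ _ h.2⟩⟩
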